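/- For $\kappa\in(0,1]$ let $\mathcal E_\kappa(z)=\sum_{m\ge 0} z^m/\Gamma(\kappa m+1)$, $z\in\mathbb R$, be the Mittag-Leffler function. For $\nu>0$ and $\kappa\in(0,1]$ write $N\sim \mathrm{FP}(\nu,\kappa)$ (fractional Poisson distribution) if $N$ has the law of $\sup\{n\ge 0:\ \Delta_1+\dots+\Delta_n\le 1\}$, where $\Delta_1,\Delta_2,\dots$ are i.i.d. waiting times with $P(\Delta_k\le t)=1-\mathcal E_\kappa(-\nu t^\kappa)$ for all $t>0$; that is, $N$ has the law of the fractional Poisson process with parameters $\nu,\kappa$ at time $1$. Write $U\sim \mathrm{ML}(\kappa)$ (type 2 Mittag-Leffler distribution) if $\kappa<1$ and $U$ has the density $$f_\kappa(u)=\frac1{\pi\kappa}\sum_{j=1}^\infty \frac{(-1)^{j-1}}{j!}\,\sin(\pi\kappa j)\,\Gamma(\kappa j+1)\,u^{j-1},\qquad u>0,$$ or if $\kappa=1$ and $U=1$ almost surely. **Statement.** Let $\nu>0$, $\kappa\in(0,1]$ and $N\sim \mathrm{FP}(\nu,\kappa)$. Then $N$ has the following mixed Poisson representation: after an extension of the probability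 space on which $N$ is defined, there is a random variable $U\sim \mathrm{ML}(\kappa)$ such that the conditional distribution of $N$ given $U$ is $\mathrm{Poisson}(\nu U)$. -/

import Mathlib

open MeasureTheory ProbabilityTheory Set

namespace FracPoisson

/-- The Mittag-Leffler function `E_κ(z) = ∑_{m ≥ 0} z ^ m / Γ(κ m + 1)` of a real argument. -/
noncomputable def mittagLeffler (κ z : ℝ) : ℝ :=
  ∑' m : ℕ, z ^ m / Real.Gamma (κ * m + 1)

/-- The density `f_κ(u)`, `u > 0`, of the (type 2) Mittag-Leffler distribution, `0 < κ < 1`. The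
summation index `j ≥ 1` is written as `j + 1` with `j ≥ 0`. -/
noncomputable def mlDensity (κ u : ℝ) : ℝ :=
  1 / (Real.pi * κ) * ∑' j : ℕ,
    (-1) ^ j / ((j + 1).factorial : ℝ) * Real.sin (Real.pi * κ * (j + 1 : ℕ)) *
      Real.Gamma (κ * (j + 1 : ℕ) + 1) * u ^ j

/-- The (type 2) Mittag-Leffler distribution `ML(κ)`, `0 < κ ≤ 1`: it has the density `f_κ` on
`(0, ∞)` for `κ < 1`, and it is the point mass at `1` for `κ = 1`. -/
noncomputable def mlMeasure (κ : ℝ) : Measure ℝ :=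
  open Classical in
  if κ < 1 then (volume.restrict (Ioi 0)).withDensity (fun u => ENNReal.ofReal (mlDensity κ u))
  else Measure.dirac 1

/-- The `n`-th jump time `T_n`, the sum of the first `n` waiting times
(numbered `Δ 0, …, Δ (n - 1)`). -/
def jumpTime {Ω : Type*} (Δ : ℕ → Ω → ℝ) (n : ℕ) (ω : Ω) : ℝ :=
  ∑ k ∈ Finset.range n, Δ k ω

/-- The counting process `N(t) = sup {n ≥ 0 : T_n ≤ t}`. -/
noncomputable def renewalCount {Ω : Type*} (Δ : ℕ → Ω → ℝ) (t : ℝ) (ω : Ω) : ℕ :=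
  sSup {n : ℕ | jumpTime Δ n ω ≤ t}

/-- `Δ` is a sequence of independent random variables, each with the distribution function
`P(Δ ≤ t) = 1 - E_κ(-ν t ^ κ)`, `t > 0` (the type 1 Mittag-Leffler distribution). -/
structure IsMLWaitingTimes (ν κ : ℝ) {Ω : Type*} [MeasurableSpace Ω]
    (Δ : ℕ → Ω → ℝ) (P : Measure Ω) : Prop where
  measurable : ∀ k, Measurable (Δ k)
  indep : iIndepFun Δ P
  cdf_eq : ∀ k, ∀ t : ℝ, 0 < t → P.real {ω | Δ k ω ≤ t} = 1 - mittagLeffler κ (-ν * t ^ κ)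

/-- `N ∼ FP(ν, κ)` under `P`: `N` has the law of the value at time `1` of the fractional Poisson
process, the renewal process with type 1 Mittag-Leffler waiting times. -/
def IsFractionalPoisson (ν κ : ℝ) {Ω : Type*} [MeasurableSpace Ω]
    (N : Ω → ℕ) (P : Measure Ω) : Prop :=
  ∃ (Ω' : Type) (_ : MeasurableSpace Ω') (P' : Measure Ω') (Δ : ℕ → Ω' → ℝ),
    IsProbabilityMeasure P' ∧ IsMLWaitingTimes ν κ Δ P' ∧
      IdentDistrib N (renewalCount Δ 1) P P'

lemma measurable_poissonMeasure_mul (ν : ℝ) :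
    Measurable fun u : ℝ => poissonMeasure (ν * u).toNNReal := by
  refine Measure.measurable_of_measurable_coe _ fun s hs => ?_
  simp only [poissonMeasure, Measure.sum_apply _ hs, Measure.smul_apply, smul_eq_mul]
  fun_prop

/-- The Markov kernel `u ↦ Poisson(ν u)`; the rate is replaced by `0` where `ν u < 0`. -/
noncomputable def poissonKernel (ν : ℝ) : Kernel ℝ ℕ where
  toFun u := poissonMeasure (ν * u).toNNReal
  measurable' := measurable_poissonMeasure_mul ν

instance (ν : ℝ) : IsMarkovKernel (poissonKernel ν) :=
  ⟨fun u => inferInstanceAs (IsProbabilityMeasure (poissonMeasure (ν * u).toNNReal))⟩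

end FracPoisson

/-! ### Growth of the Gamma function and convergence of the Mittag-Leffler series -/

namespace FracPoisson

/-! Both sides have the same probabilities, namely the values at `t = 1` of p_n(t) = ∑_j (-1)^(j+n)
C(j,n) ν^j t^(κj) / Γ(κj+1), which is `fppProb`.

For the renewal process, p_n(t) = P(T_n ≤ t) - P(T_{n+1} ≤ t) satisfies p_{n+1} = p_n * law(Δ). The
functions t^b / Γ(b+1) are stable under this convolution by the Beta integral, so the series follow
by induction (`integral_fppProb_sub`, `IsMLWaitingTimes.measureReal_jumpTime_sub`).

For the mixture with κ < 1, Hankel's formula for 1/Γ (`im_hankelIntegral`) turns the series of the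
density into f(u) = (1/π) Im ∫ exp(σ - uσ^κ) σ^(κ-1) dσ over half of Hankel's contour. This gives
decay faster than every exponential and the moments n! / Γ(κn+1). Expanding e^(-su)(su)^n / n! under
the integral, with s = νt^κ, yields p_n(t) again (`integral_poisson_weight_mul_mlDensity`). For κ =
1 the series is the Poisson probability itself.

That f is nonnegative is not visible from its series. It is deduced from p_n(t) ≥ 0 for all n and t:
the integrals of u^n e^(-su) f(u) are then nonnegative, and these weights concentrate at any
prescribed point when s = n/a (`nonneg_of_integral_pow_mul_exp_nonneg`).

Once the laws agree, U is attached to the given space by drawing it from its conditional law given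
N. -/

lemma rpow_mul_exp_neg_le_Gamma {A x : ℝ} (hA : 0 < A) (hx : 0 ≤ x) :
    A ^ x * Real.exp (-A) ≤ Real.Gamma (x + 1) := by
  rw [Real.Gamma_eq_integral (by linarith)]
  have hint := Real.GammaIntegral_convergent (s := x + 1) (by linarith)
  -- Only the part of the Gamma integral over `(A, ∞)` is kept, where `t ^ x ≥ A ^ x`.
  calc A ^ x * Real.exp (-A) = ∫ t in Ioi A, Real.exp (-t) * A ^ x := by
        rw [integral_mul_const, integral_exp_neg_Ioi]; ring
    _ ≤ ∫ t in Ioi A, Real.exp (-t) * t ^ (x + 1 - 1) := by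
        refine setIntegral_mono_on ((integrableOn_exp_neg_Ioi A).mul_const _)
          (hint.mono_set (Ioi_subset_Ioi hA.le)) measurableSet_Ioi fun t ht => ?_
        have : A ^ x ≤ t ^ x := Real.rpow_le_rpow hA.le (le_of_lt ht) hx
        simp only [add_sub_cancel_right]
        gcongr
    _ ≤ _ := by
        refine setIntegral_mono_set hint ?_ (Ioi_subset_Ioi hA.le).eventuallyLE
        filter_upwards [ae_restrict_mem measurableSet_Ioi] with t ht
        have : 0 < t := ht
        positivity

/-- The truncation level `A` of the Gamma integral is free. Taking `A ^ κ = 2 * R + 1` makes the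
Gamma factor at least `(2 * R + 1) ^ m * exp (-A)`, and `R / (2 * R + 1) ≤ 1 / 2`; the `+ 1` ensures
`A ≥ 1`, so that `b` does no harm. -/
lemma exists_pow_div_Gamma_le {κ b : ℝ} (hκ : 0 < κ) (hb : 0 ≤ b) {R : ℝ} (hR : 0 ≤ R) :
    ∃ C : ℝ, ∀ m : ℕ, R ^ m / Real.Gamma (κ * m + b + 1) ≤ C * (1 / 2) ^ m := by
  set A : ℝ := (2 * R + 1) ^ (1 / κ) with hA
  have hA0 : 0 < A := by positivity
  have hA1 : 1 ≤ A := Real.one_le_rpow (by linarith) (by positivity)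
  have hAκ : A ^ κ = 2 * R + 1 := by
    rw [hA, ← Real.rpow_mul (by positivity)]; field_simp; simp
  refine ⟨Real.exp A, fun m => ?_⟩
  have h1 := rpow_mul_exp_neg_le_Gamma (x := κ * m + b) hA0 (by positivity)
  have h2 : (2 * R + 1) ^ m * Real.exp (-A) ≤ Real.Gamma (κ * m + b + 1) := by
    refine le_trans ?_ h1
    gcongr
    rw [Real.rpow_add hA0, Real.rpow_mul hA0.le, hAκ, Real.rpow_natCast]
    exact le_mul_of_one_le_right (by positivity) (Real.one_le_rpow hA1 hb)
  have h3 : 0 < (2 * R + 1) ^ m * Real.exp (-A) := by positivity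
  calc R ^ m / Real.Gamma (κ * m + b + 1) ≤ R ^ m / ((2 * R + 1) ^ m * Real.exp (-A)) := by gcongr
    _ = Real.exp A * (R / (2 * R + 1)) ^ m := by
        rw [Real.exp_neg, div_pow]; field_simp
    _ ≤ _ := by
        refine mul_le_mul_of_nonneg_left (pow_le_pow_left₀ (by positivity) ?_ m) (Real.exp_pos _).le
        rw [div_le_div_iff₀ (by linarith) (by norm_num)]; linarith

lemma summable_pow_div_Gamma {κ b : ℝ} (hκ : 0 < κ) (hb : 0 ≤ b) {R : ℝ} (hR : 0 ≤ R) :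
    Summable fun m : ℕ => R ^ m / Real.Gamma (κ * m + b + 1) := by
  obtain ⟨C, hC⟩ := exists_pow_div_Gamma_le hκ hb hR
  refine Summable.of_nonneg_of_le (fun m => ?_) hC
    ((summable_geometric_of_lt_one (by norm_num) (by norm_num)).mul_left C)
  exact div_nonneg (by positivity) (Real.Gamma_pos_of_pos (by positivity)).le

lemma hasSum_mittagLeffler {κ : ℝ} (hκ : 0 < κ) (z : ℝ) :
    HasSum (fun m : ℕ => z ^ m / Real.Gamma (κ * m + 1)) (mittagLeffler κ z) := by
  refine (Summable.of_norm ?_).hasSum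
  have := summable_pow_div_Gamma hκ le_rfl (abs_nonneg z)
  simpa [abs_of_pos (Real.Gamma_pos_of_pos (show 0 < κ * (_ : ℕ) + 1 by positivity))] using this

/-- Continuity at `0` in quantitative form. It excludes mass of a waiting time on `(-∞, 0]`, where
the distribution function is not prescribed. -/
lemma abs_mittagLeffler_sub_one_le {κ : ℝ} (hκ : 0 < κ) :
    ∃ C : ℝ, ∀ z : ℝ, |z| ≤ 1 → |mittagLeffler κ z - 1| ≤ C * |z| := by
  have hs := summable_pow_div_Gamma hκ hκ.le (zero_le_one (α := ℝ))
  refine ⟨∑' m : ℕ, 1 ^ m / Real.Gamma (κ * m + κ + 1), fun z hz => ?_⟩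
  have h := (hasSum_nat_add_iff' 1).2 (hasSum_mittagLeffler hκ z)
  simp only [Finset.range_one, Finset.sum_singleton, pow_zero, Nat.cast_zero, mul_zero, zero_add,
    Real.Gamma_one, div_one] at h
  rw [← h.tsum_eq, ← tsum_mul_right, ← Real.norm_eq_abs]
  refine tsum_of_norm_bounded (hs.mul_right |z|).hasSum fun m => ?_
  have e : κ * ((m + 1 : ℕ) : ℝ) + 1 = κ * m + κ + 1 := by push_cast; ring
  have hp : 0 < Real.Gamma (κ * m + κ + 1) := Real.Gamma_pos_of_pos (by positivity)
  rw [e, norm_div, Real.norm_of_nonneg hp.le, norm_pow, Real.norm_eq_abs, one_pow, pow_succ,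
    div_mul_eq_mul_div]
  gcongr
  exact pow_le_one₀ (abs_nonneg z) hz

end FracPoisson

/-! ### Hankel's formula in the logarithmic coordinate -/

namespace FracPoisson

open Filter Topology Complex

/-- As κ < 1, `exp x` dominates both `exp (κ * x)` and `x` near infinity, and compactness covers the
rest. All dominations along the rays of the contour come from this bound. -/
lemma exists_exponent_le {b κ : ℝ} (hb : 0 < b) (hκ1 : κ < 1) (A B x₀ : ℝ) :
    ∃ C : ℝ, ∀ x, x₀ ≤ x → -b * Real.exp x + A * Real.exp (κ * x) + B * x ≤ C - x := by
  have hlim : Tendsto (fun x : ℝ => Real.exp x *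
      (-b + A * Real.exp (-(1 - κ) * x) + (B + 1) * (x * Real.exp (-x)))) atTop atBot := by
    refine Real.tendsto_exp_atTop.atTop_mul_neg (C := -b) (by linarith) ?_
    have h1 : Tendsto (fun x : ℝ => Real.exp (-(1 - κ) * x)) atTop (𝓝 0) :=
      Real.tendsto_exp_atBot.comp (tendsto_id.const_mul_atTop_of_neg (by linarith))
    have h2 : Tendsto (fun x : ℝ => x * Real.exp (-x)) atTop (𝓝 0) := by
      simpa using Real.tendsto_pow_mul_exp_neg_atTop_nhds_zero 1
    simpa using (tendsto_const_nhds (x := -b)).add (h1.const_mul A) |>.add (h2.const_mul (B + 1))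
  obtain ⟨X, hX⟩ := eventually_atTop.1 (hlim.eventually (eventually_le_atBot 0))
  obtain ⟨C, hC⟩ := (isCompact_Icc (a := x₀) (b := X)).bddAbove_image
    (f := fun x : ℝ => -b * Real.exp x + A * Real.exp (κ * x) + B * x + x)
    (Continuous.continuousOn (by fun_prop))
  refine ⟨max C 0, fun x hx => ?_⟩
  rcases le_total x X with h | h
  · have := hC ⟨x, ⟨hx, h⟩, rfl⟩
    simp only at this
    linarith [le_max_left C 0]
  · have h1 := hX x h
    have h2 : Real.exp x * (-b + A * Real.exp (-(1 - κ) * x) + (B + 1) * (x * Real.exp (-x)))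
        = -b * Real.exp x + A * Real.exp (κ * x) + B * x + x := by
      have e1 : Real.exp (κ * x) = Real.exp x * Real.exp (-(1 - κ) * x) := by
        rw [← Real.exp_add]; ring_nf
      have e2 : Real.exp x * Real.exp (-x) = 1 := by rw [← Real.exp_add]; simp
      rw [e1]; linear_combination (B + 1) * x * e2
    rw [h2] at h1
    linarith [le_max_right C 0]

/-- The integrand `exp (σ) σ ^ (-z) dσ` of Hankel's integral in the coordinate `σ = exp w`. -/
noncomputable def hankelKernel (z : ℝ) (w : ℂ) : ℂ := cexp (cexp w + (1 - z) * w)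

/-- The integral of `H` along the path from `x₀` vertically up to `x₀ + φ i`, and then horizontally
to `∞ + φ i`. -/
noncomputable def hankelIntegral (φ x₀ : ℝ) (H : ℂ → ℂ) : ℂ :=
  I * (∫ y in (0 : ℝ)..φ, H (x₀ + y * I)) + ∫ x in Ioi x₀, H (x + φ * I)

lemma norm_hankelKernel (z x y : ℝ) :
    ‖hankelKernel z (x + y * I)‖ = Real.exp (Real.exp x * Real.cos y + (1 - z) * x) := by
  simp [hankelKernel, Complex.norm_exp, Complex.exp_re]

lemma differentiable_hankelKernel (z : ℝ) : Differentiable ℂ (hankelKernel z) := by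
  unfold hankelKernel; fun_prop

@[fun_prop]
lemma continuous_hankelKernel (z : ℝ) : Continuous (hankelKernel z) :=
  (differentiable_hankelKernel z).continuous

/-- Reality on the real axis is why the upper half of Hankel's contour and its imaginary part
suffice. -/
lemma hankelKernel_ofReal_im (z x : ℝ) : (hankelKernel z x).im = 0 := by
  have : hankelKernel z x = (Real.exp (Real.exp x + (1 - z) * x) : ℝ) := by
    simp [hankelKernel]
  rw [this, ofReal_im]

lemma exists_norm_hankelKernel_le {φ : ℝ} (h1 : Real.pi / 2 < φ) (h2 : φ ≤ Real.pi) (z x₀ : ℝ) :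
    ∃ C : ℝ, ∀ x y : ℝ, x₀ ≤ x → φ ≤ y → y ≤ Real.pi →
      ‖hankelKernel z (x + y * I)‖ ≤ C * Real.exp (-x) := by
  have hb : 0 < -Real.cos φ := by
    have := Real.cos_neg_of_pi_div_two_lt_of_lt h1 (by linarith [Real.pi_pos])
    linarith
  obtain ⟨C, hC⟩ := exists_exponent_le hb (show (0 : ℝ) < 1 by norm_num) 0 (1 - z) x₀
  refine ⟨Real.exp C, fun x y hx hy hy' => ?_⟩
  rw [norm_hankelKernel, ← Real.exp_add]
  have := hC x hx
  have hc : Real.cos y ≤ Real.cos φ :=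
    Real.cos_le_cos_of_nonneg_of_le_pi (by linarith [Real.pi_pos]) hy' hy
  have := mul_le_mul_of_nonneg_left hc (Real.exp_pos x).le
  refine Real.exp_le_exp.2 ?_
  linarith

lemma integrableOn_hankelKernel {φ : ℝ} (h1 : Real.pi / 2 < φ) (h2 : φ ≤ Real.pi) (z x₀ : ℝ) :
    IntegrableOn (fun x : ℝ => hankelKernel z (x + φ * I)) (Ioi x₀) := by
  obtain ⟨C, hC⟩ := exists_norm_hankelKernel_le h1 h2 z x₀
  refine Integrable.mono' ((integrableOn_exp_neg_Ioi x₀).const_mul C)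
    (Continuous.aestronglyMeasurable (by fun_prop)) ?_
  filter_upwards [ae_restrict_mem measurableSet_Ioi] with x hx
  exact hC x φ (le_of_lt hx) le_rfl h2

/-- Cauchy's theorem on the rectangle over `[x₀, x₁]` of height `φ`: the two contours differ by a
segment of the real axis, whose contribution is real. Hence the radius `exp x₀` of the arc is free.
-/
lemma im_hankelIntegral_eq {φ : ℝ} (h1 : Real.pi / 2 < φ) (h2 : φ ≤ Real.pi) (z x₀ x₁ : ℝ) :
    (hankelIntegral φ x₀ (hankelKernel z)).im = (hankelIntegral φ x₁ (hankelKernel z)).im := by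
  have hc := Complex.integral_boundary_rect_eq_zero_of_differentiableOn (hankelKernel z)
    (x₀ : ℂ) (x₁ + φ * I) (differentiable_hankelKernel z).differentiableOn
  simp only [ofReal_re, ofReal_im, add_re, mul_re, I_re, mul_zero, I_im, mul_one, sub_self,
    add_zero, add_im, mul_im, zero_add, ofReal_zero, zero_mul, smul_eq_mul] at hc
  have hsplit : ∫ x in Ioi x₀, hankelKernel z (x + φ * I) =
      (∫ x in x₀..x₁, hankelKernel z (x + φ * I)) + ∫ x in Ioi x₁, hankelKernel z (x + φ * I) := by
    rw [intervalIntegral.integral_interval_add_Ioi]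
    · exact integrableOn_hankelKernel h1 h2 z x₀
    · exact integrableOn_hankelKernel h1 h2 z x₁
  have hreal : (∫ x in x₀..x₁, hankelKernel z x).im = 0 := by
    have e : ∀ x : ℝ, hankelKernel z x = ((hankelKernel z x).re : ℝ) := fun x =>
      Complex.ext rfl (by rw [hankelKernel_ofReal_im, ofReal_im])
    rw [intervalIntegral.integral_congr fun x _ => e x, intervalIntegral.integral_ofReal,
      ofReal_im]
  have : hankelIntegral φ x₀ (hankelKernel z) - hankelIntegral φ x₁ (hankelKernel z) =
      ∫ x in x₀..x₁, hankelKernel z x := by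
    rw [hankelIntegral, hankelIntegral, hsplit]
    linear_combination -hc
  have := congrArg Complex.im this
  rw [hreal, sub_im] at this
  linarith

/-- Cauchy's theorem on `[x₀, R] × [φ, π]`; the right edge vanishes as `R → ∞` because the cosine
stays negative there. -/
lemma hankelIntegral_angle {φ : ℝ} (h1 : Real.pi / 2 < φ) (h2 : φ ≤ Real.pi) (z x₀ : ℝ) :
    hankelIntegral φ x₀ (hankelKernel z) = hankelIntegral Real.pi x₀ (hankelKernel z) := by
  have hpi : Real.pi / 2 < Real.pi := by linarith [Real.pi_pos]
  obtain ⟨C, hC⟩ := exists_norm_hankelKernel_le h1 h2 z x₀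
  have hc := fun R : ℝ => Complex.integral_boundary_rect_eq_zero_of_differentiableOn
    (hankelKernel z) (x₀ + φ * I) (R + Real.pi * I)
    (differentiable_hankelKernel z).differentiableOn
  simp only [ofReal_re, ofReal_im, add_re, mul_re, I_re, mul_zero, I_im, mul_one, sub_self,
    add_zero, add_im, mul_im, zero_add, smul_eq_mul] at hc
  have t1 := intervalIntegral_tendsto_integral_Ioi x₀ (integrableOn_hankelKernel h1 h2 z x₀)
    tendsto_id
  have t2 := intervalIntegral_tendsto_integral_Ioi x₀
    (integrableOn_hankelKernel hpi le_rfl z x₀) tendsto_id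
  have t3 : Tendsto (fun R : ℝ => I * ∫ y in φ..Real.pi, hankelKernel z (R + y * I)) atTop
      (𝓝 0) := by
    rw [← mul_zero I]
    refine Tendsto.const_mul I ?_
    have hlim : Tendsto (fun R : ℝ => C * Real.exp (-R) * |Real.pi - φ|) atTop (𝓝 0) := by
      simpa using (Real.tendsto_exp_neg_atTop_nhds_zero.const_mul C).mul_const |Real.pi - φ|
    refine squeeze_zero_norm' ?_ hlim
    filter_upwards [eventually_ge_atTop x₀] with R hR
    refine intervalIntegral.norm_integral_le_of_norm_le_const fun y hy => ?_
    rw [uIoc_of_le h2] at hy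
    exact hC R y hR hy.1.le hy.2
  have t4 := ((t1.sub t2).add t3).sub_const
    (I * ∫ y in φ..Real.pi, hankelKernel z (x₀ + y * I))
  simp only [id] at t4
  simp_rw [hc] at t4
  have h0 := tendsto_nhds_unique tendsto_const_nhds t4
  have hadd := intervalIntegral.integral_add_adjacent_intervals (μ := volume)
    (f := fun y : ℝ => hankelKernel z (x₀ + y * I)) (a := 0) (b := φ) (c := Real.pi)
    (Continuous.intervalIntegrable (by fun_prop) _ _)
    (Continuous.intervalIntegrable (by fun_prop) _ _)
  rw [hankelIntegral, hankelIntegral, ← hadd]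
  linear_combination -h0

lemma hankelKernel_add_pi (z x : ℝ) :
    hankelKernel z (x + Real.pi * I) =
      (Real.exp (-Real.exp x + (1 - z) * x) : ℝ) * cexp ((Real.pi * (1 - z) : ℝ) * I) := by
  rw [hankelKernel, Complex.exp_add (x : ℂ), Complex.exp_pi_mul_I]
  push_cast
  rw [← Complex.exp_add]
  congr 1; ring

lemma im_integral_hankelKernel_pi (z x₀ : ℝ) :
    (∫ x in Ioi x₀, hankelKernel z (x + Real.pi * I)).im =
      Real.sin (Real.pi * z) * ∫ x in Ioi x₀, Real.exp (-Real.exp x + (1 - z) * x) := by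
  simp_rw [hankelKernel_add_pi]
  rw [integral_mul_const, integral_complex_ofReal, im_ofReal_mul, exp_ofReal_mul_I_im, mul_sub,
    mul_one, Real.sin_pi_sub, mul_comm]

lemma integral_exp_neg_exp (z x₀ : ℝ) :
    ∫ x in Ioi x₀, Real.exp (-Real.exp x + (1 - z) * x) =
      ∫ t in Ioi (Real.exp x₀), Real.exp (-t) * t ^ (1 - z - 1) := by
  rw [← integral_comp_exp_Ioi]
  refine setIntegral_congr_fun measurableSet_Ioi fun x _ => ?_
  simp only [smul_eq_mul]
  rw [← Real.exp_mul, ← Real.exp_add, ← Real.exp_add]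
  congr 1; ring

lemma tendsto_integral_exp_neg_exp {z : ℝ} (hz : z < 1) :
    Tendsto (fun x₀ : ℝ => ∫ x in Ioi x₀, Real.exp (-Real.exp x + (1 - z) * x)) atBot
      (𝓝 (Real.Gamma (1 - z))) := by
  simp_rw [integral_exp_neg_exp]
  rw [Real.Gamma_eq_integral (by linarith)]
  have hc : AECover (volume.restrict (Ioi (0 : ℝ))) atBot fun x : ℝ => Ioi (Real.exp x) :=
    aecover_Ioi_of_Ioi Real.tendsto_exp_atBot
  have := hc.integral_tendsto_of_countably_generated
    (Real.GammaIntegral_convergent (s := 1 - z) (by linarith))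
  refine this.congr fun x => ?_
  rw [Measure.restrict_restrict measurableSet_Ioi,
    inter_eq_left.2 (Ioi_subset_Ioi (Real.exp_pos x).le)]

lemma sin_pi_mul_mul_Gamma_one_sub {z : ℝ} (hz : z < 1) :
    Real.sin (Real.pi * z) * Real.Gamma (1 - z) = Real.pi / Real.Gamma z := by
  have h := Real.Gamma_mul_Gamma_one_sub z
  have hg : Real.Gamma (1 - z) ≠ 0 := (Real.Gamma_pos_of_pos (by linarith)).ne'
  rcases eq_or_ne (Real.sin (Real.pi * z)) 0 with hs | hs
  -- At the nonpositive integers both sides are `0`, by the conventions for `Gamma` at its poles and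
  -- for division by zero.
  · rw [hs, div_zero] at h
    rw [hs, (mul_eq_zero.1 h).resolve_right hg]; simp
  · rw [eq_div_iff hs] at h
    have h0 : Real.Gamma z ≠ 0 := by
      rintro h0; rw [h0] at h; simp [Real.pi_ne_zero.symm] at h
    rw [eq_div_iff h0]; linarith

lemma norm_hankelKernel_le (z x y : ℝ) :
    ‖hankelKernel z (x + y * I)‖ ≤ Real.exp (Real.exp x + (1 - z) * x) := by
  rw [norm_hankelKernel]
  have := mul_le_mul_of_nonneg_left (Real.cos_le_one y) (Real.exp_pos x).le
  exact Real.exp_le_exp.2 (by linarith)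

/-- Let the radius tend to `0`. The arc vanishes since `z < 1`, and the ray tends to `sin (π z) Γ(1
- z)`, to which the reflection formula applies. -/
lemma im_hankelIntegral_pi_of_lt_one {z : ℝ} (hz : z < 1) (x₀ : ℝ) :
    (hankelIntegral Real.pi x₀ (hankelKernel z)).im = Real.pi / Real.Gamma z := by
  have hpi : Real.pi / 2 < Real.pi := by linarith [Real.pi_pos]
  have t1 : Tendsto (fun x : ℝ => I * ∫ y in (0 : ℝ)..Real.pi, hankelKernel z (x + y * I)) atBot
      (𝓝 0) := by
    rw [← mul_zero I]
    refine Tendsto.const_mul I ?_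
    have hlim : Tendsto (fun x : ℝ => Real.exp (Real.exp x + (1 - z) * x) * |Real.pi - 0|) atBot
        (𝓝 0) := by
      have : Tendsto (fun x : ℝ => Real.exp x + (1 - z) * x) atBot atBot :=
        Real.tendsto_exp_atBot.add_atBot (tendsto_id.const_mul_atBot (by linarith))
      simpa using (Real.tendsto_exp_atBot.comp this).mul_const |Real.pi - 0|
    refine squeeze_zero_norm (fun x => ?_) hlim
    exact intervalIntegral.norm_integral_le_of_norm_le_const fun y _ => norm_hankelKernel_le z x y
  have t2 : Tendsto (fun x : ℝ => (hankelIntegral Real.pi x (hankelKernel z)).im) atBot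
      (𝓝 (Real.pi / Real.Gamma z)) := by
    have h1 := (Complex.continuous_im.tendsto _).comp t1
    have h2 := (tendsto_integral_exp_neg_exp hz).const_mul (Real.sin (Real.pi * z))
    rw [sin_pi_mul_mul_Gamma_one_sub hz] at h2
    simpa [hankelIntegral, im_integral_hankelKernel_pi] using h1.add h2
  exact tendsto_nhds_unique (tendsto_const_nhds.congr fun x =>
    im_hankelIntegral_eq hpi le_rfl z x₀ x) t2

/-- In this borderline case the arc does not vanish: the kernel tends to `1` on it, so the arc tends
to `π i`, while the ray is real. -/
lemma im_hankelIntegral_pi_one (x₀ : ℝ) :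
    (hankelIntegral Real.pi x₀ (hankelKernel 1)).im = Real.pi := by
  have hpi : Real.pi / 2 < Real.pi := by linarith [Real.pi_pos]
  have t1 : Tendsto (fun x : ℝ => I * ∫ y in (0 : ℝ)..Real.pi, hankelKernel 1 (x + y * I)) atBot
      (𝓝 (I * Real.pi)) := by
    refine Tendsto.const_mul I ?_
    have hlim : Tendsto (fun x : ℝ => 2 * Real.exp x * |Real.pi - 0|) atBot (𝓝 0) := by
      simpa using (Real.tendsto_exp_atBot.const_mul 2).mul_const |Real.pi - 0|
    rw [tendsto_iff_norm_sub_tendsto_zero]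
    refine squeeze_zero_norm' ?_ hlim
    filter_upwards [eventually_le_atBot 0] with x hx
    have e : (∫ y in (0 : ℝ)..Real.pi, hankelKernel 1 (x + y * I)) - Real.pi =
        ∫ y in (0 : ℝ)..Real.pi, (hankelKernel 1 (x + y * I) - 1) := by
      rw [intervalIntegral.integral_sub (Continuous.intervalIntegrable (by fun_prop) _ _)
        intervalIntegrable_const]
      simp
    rw [e, norm_norm]
    refine intervalIntegral.norm_integral_le_of_norm_le_const fun y _ => ?_
    have hn : ‖cexp (x + y * I)‖ = Real.exp x := by simp [Complex.norm_exp]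
    have := Complex.norm_exp_sub_one_le (x := cexp (x + y * I))
      (by rw [hn]; exact Real.exp_le_one_iff.2 hx)
    rw [hn] at this
    simpa [hankelKernel] using this
  have t2 : Tendsto (fun x : ℝ => (hankelIntegral Real.pi x (hankelKernel 1)).im) atBot
      (𝓝 Real.pi) := by
    have h1 := (Complex.continuous_im.tendsto _).comp t1
    simpa [hankelIntegral, im_integral_hankelKernel_pi, Function.comp_def] using h1
  exact tendsto_nhds_unique (tendsto_const_nhds.congr fun x =>
    im_hankelIntegral_eq hpi le_rfl 1 x₀ x) t2

/-- Integration by parts, the counterpart of `Γ(z + 1) = z Γ(z)`: the derivative of `hankelKernel (z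
+ 1)` is `hankelKernel z - z * hankelKernel (z + 1)`, and the remaining boundary value lies on the
real axis. -/
lemma im_hankelIntegral_pi_add_one (z x₀ : ℝ) :
    (hankelIntegral Real.pi x₀ (hankelKernel z)).im =
      z * (hankelIntegral Real.pi x₀ (hankelKernel (z + 1))).im := by
  have hpi : Real.pi / 2 < Real.pi := by linarith [Real.pi_pos]
  set G : ℂ → ℂ := fun w => hankelKernel (z + 1) w with hG
  have hd : ∀ w, HasDerivAt G (hankelKernel z w - z * hankelKernel (z + 1) w) w := by
    intro w
    have : HasDerivAt (fun w : ℂ => cexp w + (1 - ((z + 1 : ℝ) : ℂ)) * w)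
        (cexp w + (1 - ((z + 1 : ℝ) : ℂ)) * 1) w :=
      (Complex.hasDerivAt_exp w).add ((hasDerivAt_id w).const_mul _)
    convert! this.cexp using 1
    have e : hankelKernel z w = cexp (cexp w + (1 - ((z + 1 : ℝ) : ℂ)) * w) * cexp w := by
      rw [hankelKernel, ← Complex.exp_add]; congr 1; push_cast; ring
    rw [e, hankelKernel]; push_cast; ring
  have i1 := integrableOn_hankelKernel hpi le_rfl z x₀
  have i2 := (integrableOn_hankelKernel hpi le_rfl (z + 1) x₀).const_mul (z : ℂ)
  have hv : I * ∫ y in (0 : ℝ)..Real.pi,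
      (hankelKernel z (x₀ + y * I) - z * hankelKernel (z + 1) (x₀ + y * I)) =
      G (x₀ + Real.pi * I) - G (x₀ + (0 : ℝ) * I) := by
    rw [← intervalIntegral.integral_const_mul]
    refine intervalIntegral.integral_eq_sub_of_hasDerivAt (f := fun y : ℝ => G (x₀ + y * I))
      (fun y _ => ?_) (Continuous.intervalIntegrable (by fun_prop) _ _)
    have h1 : HasDerivAt (fun y : ℂ => (x₀ : ℂ) + y * I) I y := by
      simpa using ((hasDerivAt_id (y : ℂ)).mul_const I).const_add (x₀ : ℂ)
    have := ((hd (x₀ + y * I)).comp (y : ℂ) h1).comp_ofReal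
    rw [mul_comm]; exact this
  have hh : ∫ x in Ioi x₀,
      (hankelKernel z (x + Real.pi * I) - z * hankelKernel (z + 1) (x + Real.pi * I)) =
      0 - G (x₀ + Real.pi * I) := by
    refine integral_Ioi_of_hasDerivAt_of_tendsto' (f := fun x : ℝ => G (x + Real.pi * I))
      (fun x _ => ?_) (i1.sub i2) ?_
    · have h1 : HasDerivAt (fun y : ℂ => y + Real.pi * I) 1 (x : ℂ) :=
        (hasDerivAt_id (x : ℂ)).add_const _
      simpa using ((hd (x + Real.pi * I)).comp (x : ℂ) h1).comp_ofReal
    · obtain ⟨C, hC⟩ := exists_norm_hankelKernel_le hpi le_rfl (z + 1) x₀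
      refine squeeze_zero_norm' (a := fun x => C * Real.exp (-x)) ?_
        (by simpa using Real.tendsto_exp_neg_atTop_nhds_zero.const_mul C)
      filter_upwards [eventually_ge_atTop x₀] with x hx
      exact hC x _ hx le_rfl le_rfl
  rw [intervalIntegral.integral_sub (Continuous.intervalIntegrable (by fun_prop) _ _)
    (Continuous.intervalIntegrable (by fun_prop) _ _), intervalIntegral.integral_const_mul] at hv
  rw [integral_sub i1 i2, integral_const_mul] at hh
  have : hankelIntegral Real.pi x₀ (hankelKernel z) -
      z * hankelIntegral Real.pi x₀ (hankelKernel (z + 1)) = -G x₀ := by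
    rw [hankelIntegral, hankelIntegral]
    simp only [ofReal_zero, zero_mul, add_zero] at hv
    linear_combination hv + hh
  have := congrArg Complex.im this
  rw [neg_im, hG, hankelKernel_ofReal_im, sub_im, im_ofReal_mul] at this
  linarith

/-- **Hankel's formula** for the reciprocal of the Gamma function. -/
theorem im_hankelIntegral {φ : ℝ} (h1 : Real.pi / 2 < φ) (h2 : φ ≤ Real.pi) (z x₀ : ℝ) :
    (hankelIntegral φ x₀ (hankelKernel z)).im = Real.pi / Real.Gamma z := by
  rw [hankelIntegral_angle h1 h2]
  -- Shrinking the arc only reaches `z ≤ 1`; the recurrence extends the formula upwards in unit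
  -- steps.
  have main : ∀ n : ℕ, ∀ z : ℝ, z ≤ n + 1 →
      (hankelIntegral Real.pi x₀ (hankelKernel z)).im = Real.pi / Real.Gamma z := by
    intro n
    induction n with
    | zero =>
      intro z hz
      rcases (show z ≤ 1 by simpa using hz).lt_or_eq with h | rfl
      · exact im_hankelIntegral_pi_of_lt_one h x₀
      · rw [im_hankelIntegral_pi_one, Real.Gamma_one, div_one]
    | succ n ih =>
      intro z hz
      rcases lt_or_ge z 1 with h | h
      · exact im_hankelIntegral_pi_of_lt_one h x₀
      rcases h.eq_or_lt with rfl | h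
      · rw [im_hankelIntegral_pi_one, Real.Gamma_one, div_one]
      have h3 := ih (z - 1) (by push_cast at hz; linarith)
      have hz0 : z - 1 ≠ 0 := by linarith
      have h4 := Real.Gamma_add_one hz0
      have hg : 0 < Real.Gamma (z - 1) := Real.Gamma_pos_of_pos (by linarith)
      rw [im_hankelIntegral_pi_add_one] at h3
      rw [sub_add_cancel] at h3 h4
      rw [h4]
      field_simp at h3 ⊢
      linarith
  obtain ⟨n, hn⟩ := exists_nat_ge z
  exact main n z (by linarith)

end FracPoisson

/-! ### Contour integral for the Mittag-Leffler density -/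

namespace FracPoisson

open Filter Topology Complex

/-- The real part of the point with parameter `s > 0` on the path of `hankelIntegral`. -/
noncomputable def hankelRe (φ x₀ s : ℝ) : ℝ := x₀ + max (s - φ) 0

/-- The path of `hankelIntegral`, parametrized by arc length. -/
noncomputable def hankelPath (φ x₀ s : ℝ) : ℂ := (hankelRe φ x₀ s : ℂ) + (min s φ : ℝ) * I

/-- The integrand `exp σ dσ / σ` along `hankelPath`, in the coordinate `σ = exp w`. -/
noncomputable def hankelWeight (φ x₀ s : ℝ) : ℂ :=
  (if s ≤ φ then I else 1) * cexp (cexp (hankelPath φ x₀ s))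

@[fun_prop]
lemma continuous_hankelRe (φ x₀ : ℝ) : Continuous (hankelRe φ x₀) := by
  unfold hankelRe; fun_prop

@[fun_prop]
lemma continuous_hankelPath (φ x₀ : ℝ) : Continuous (hankelPath φ x₀) := by
  unfold hankelPath; fun_prop

@[fun_prop]
lemma measurable_hankelWeight (φ x₀ : ℝ) : Measurable (hankelWeight φ x₀) := by
  unfold hankelWeight
  exact (Measurable.ite measurableSet_Iic measurable_const measurable_const).mul
    (Continuous.measurable (by fun_prop))

@[simp] lemma re_hankelPath (φ x₀ s : ℝ) : (hankelPath φ x₀ s).re = hankelRe φ x₀ s := by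
  simp [hankelPath]

@[simp] lemma im_hankelPath (φ x₀ s : ℝ) : (hankelPath φ x₀ s).im = min s φ := by
  simp [hankelPath]

lemma le_hankelRe (φ x₀ s : ℝ) : x₀ ≤ hankelRe φ x₀ s := by simp [hankelRe]

lemma exists_norm_hankelWeight_mul_le {φ κ : ℝ} (h1 : Real.pi / 2 < φ) (h2 : φ ≤ Real.pi)
    (hκ1 : κ < 1) (A B x₀ : ℝ) :
    ∃ C : ℝ, ∀ s : ℝ, ‖hankelWeight φ x₀ s‖ *
      Real.exp (A * Real.exp (κ * hankelRe φ x₀ s) + B * hankelRe φ x₀ s) ≤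
        C * Real.exp (-s) := by
  have hb : 0 < -Real.cos φ := by
    have := Real.cos_neg_of_pi_div_two_lt_of_lt h1 (by linarith [Real.pi_pos])
    linarith
  obtain ⟨C, hC⟩ := exists_exponent_le hb hκ1 A B x₀
  -- The term `2 * exp x₀` absorbs the arc, where the cosine may be positive; `φ - x₀` converts
  -- decay in `hankelRe` into decay in `s`.
  refine ⟨Real.exp (C + 2 * Real.exp x₀ + φ - x₀), fun s => ?_⟩
  have hx := hC _ (le_hankelRe φ x₀ s)
  have hs : x₀ + s - φ ≤ hankelRe φ x₀ s := by
    rw [hankelRe]; linarith [le_max_left (s - φ) 0]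
  have hw : ‖hankelWeight φ x₀ s‖ ≤
      Real.exp (2 * Real.exp x₀ - (-Real.cos φ) * Real.exp (hankelRe φ x₀ s)) := by
    have e : ‖(if s ≤ φ then I else 1 : ℂ)‖ = 1 := by split_ifs <;> simp
    rw [hankelWeight, norm_mul, e, one_mul, Complex.norm_exp, Complex.exp_re, re_hankelPath,
      im_hankelPath]
    refine Real.exp_le_exp.2 ?_
    rcases le_or_gt s φ with h | h
    · have e1 : hankelRe φ x₀ s = x₀ := by simp [hankelRe, h]
      rw [e1]
      have h3 := mul_le_mul_of_nonneg_left (Real.cos_le_one (min s φ)) (Real.exp_pos x₀).le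
      have h4 := mul_le_mul_of_nonneg_left (Real.neg_one_le_cos φ) (Real.exp_pos x₀).le
      linarith
    · rw [min_eq_right h.le]
      linarith [Real.exp_pos x₀]
  refine (mul_le_mul_of_nonneg_right hw (Real.exp_pos _).le).trans ?_
  rw [← Real.exp_add, ← Real.exp_add]
  refine Real.exp_le_exp.2 ?_
  linarith

lemma integrableOn_hankelWeight_mul {φ κ : ℝ} (h1 : Real.pi / 2 < φ) (h2 : φ ≤ Real.pi)
    (hκ1 : κ < 1) (A B x₀ : ℝ) :
    IntegrableOn (fun s => ‖hankelWeight φ x₀ s‖ *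
      Real.exp (A * Real.exp (κ * hankelRe φ x₀ s) + B * hankelRe φ x₀ s)) (Ioi 0) := by
  obtain ⟨C, hC⟩ := exists_norm_hankelWeight_mul_le h1 h2 hκ1 A B x₀
  refine Integrable.mono' ((integrableOn_exp_neg_Ioi 0).const_mul C)
    (Measurable.aestronglyMeasurable (by fun_prop)) (Eventually.of_forall fun s => ?_)
  rw [Real.norm_of_nonneg (by positivity)]
  exact hC s

lemma integrableOn_hankelWeight_mul_cexp {φ : ℝ} (h1 : Real.pi / 2 < φ) (h2 : φ ≤ Real.pi)
    (a x₀ : ℝ) :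
    IntegrableOn (fun s => hankelWeight φ x₀ s * cexp (a * hankelPath φ x₀ s)) (Ioi 0) := by
  refine Integrable.mono' (integrableOn_hankelWeight_mul h1 h2 zero_lt_one 0 a x₀)
    (Measurable.aestronglyMeasurable (by fun_prop)) (Eventually.of_forall fun s => ?_)
  rw [norm_mul, Complex.norm_exp]
  simp

/-- Hankel's formula as a single integral over `(0, ∞)`, the form suited to dominated convergence
and Fubini. -/
lemma im_integral_hankelWeight_mul_cexp {φ : ℝ} (h1 : Real.pi / 2 < φ) (h2 : φ ≤ Real.pi)
    (z x₀ : ℝ) :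
    (∫ s in Ioi 0, hankelWeight φ x₀ s * cexp ((1 - z : ℝ) * hankelPath φ x₀ s)).im =
      Real.pi / Real.Gamma z := by
  rw [← im_hankelIntegral h1 h2 z x₀]
  congr 1
  have hφ : 0 < φ := by linarith [Real.pi_pos]
  have hi := integrableOn_hankelWeight_mul_cexp h1 h2 (1 - z) x₀
  rw [← intervalIntegral.integral_interval_add_Ioi hi (hi.mono_set (Ioi_subset_Ioi hφ.le)),
    hankelIntegral, ← intervalIntegral.integral_const_mul]
  congr 1
  · refine intervalIntegral.integral_congr fun s hs => ?_
    rw [uIcc_of_le hφ.le] at hs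
    have e : hankelPath φ x₀ s = x₀ + s * I := by simp [hankelPath, hankelRe, hs.2]
    simp only [hankelWeight, if_pos hs.2, e, hankelKernel]
    rw [Complex.exp_add (cexp _)]; push_cast; ring
  · have := (measurePreserving_add_right volume (φ - x₀)).setIntegral_preimage_emb
      (measurableEmbedding_addRight (φ - x₀))
      (fun s => hankelWeight φ x₀ s * cexp ((1 - z : ℝ) * hankelPath φ x₀ s)) (Ioi φ)
    rw [← this, preimage_add_const_Ioi, sub_sub_cancel]
    refine setIntegral_congr_fun measurableSet_Ioi fun x hx => ?_
    have hx' : x₀ < x := hx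
    have e : hankelPath φ x₀ (x + (φ - x₀)) = x + φ * I := by
      rw [hankelPath, hankelRe, max_eq_left (by linarith), min_eq_right (by linarith)]
      push_cast; ring
    simp only [hankelWeight, if_neg (show ¬ x + (φ - x₀) ≤ φ by linarith), e, hankelKernel]
    rw [Complex.exp_add (cexp _)]; push_cast; ring

lemma norm_cexp_mul_hankelPath (a φ x₀ s : ℝ) :
    ‖cexp (a * hankelPath φ x₀ s)‖ = Real.exp (a * hankelRe φ x₀ s) := by
  rw [Complex.norm_exp]; simp

/-- The reflection formula converts the sine and Gamma factors into `1 / Γ(1 - κ(j + 1))`; the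
factor `κ(j + 1)` from `Γ(κ(j + 1) + 1)` cancels `κ` and reduces the factorial. -/
lemma mlDensity_term {κ : ℝ} (hκ0 : 0 < κ) (u : ℝ) (j : ℕ) :
    1 / (Real.pi * κ) * ((-1) ^ j / ((j + 1).factorial : ℝ) *
      Real.sin (Real.pi * κ * (j + 1 : ℕ)) * Real.Gamma (κ * (j + 1 : ℕ) + 1) * u ^ j) =
    1 / Real.pi * ((-u) ^ j / (j.factorial : ℝ) *
      (Real.pi / Real.Gamma (1 - κ * (j + 1 : ℕ)))) := by
  have hpos : 0 < κ * (j + 1 : ℕ) := by positivity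
  rw [← sin_pi_mul_mul_Gamma_one_sub (by linarith), sub_sub_cancel, mul_sub, mul_one,
    Real.sin_pi_sub, Real.Gamma_add_one hpos.ne', Nat.factorial_succ, neg_pow u, ← mul_assoc Real.pi]
  have := Real.pi_ne_zero
  have : (j.factorial : ℝ) ≠ 0 := by positivity
  push_cast
  have : (j : ℝ) + 1 ≠ 0 := by positivity
  field_simp

/-- The integral representation of the density of the Mittag-Leffler distribution. -/
lemma mlDensity_eq_integral {φ κ : ℝ} (h1 : Real.pi / 2 < φ) (h2 : φ ≤ Real.pi) (hκ0 : 0 < κ)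
    (hκ1 : κ < 1) (x₀ u : ℝ) :
    mlDensity κ u = 1 / Real.pi * (∫ s in Ioi 0, hankelWeight φ x₀ s *
      cexp (κ * hankelPath φ x₀ s) * cexp (-u * cexp (κ * hankelPath φ x₀ s))).im := by
  -- The exponential `exp (-u σ ^ κ)` is expanded in powers; the `j`-th term is Hankel's integral at
  -- `z = 1 - κ(j + 1)`. The majorants sum to an integrable function because κ < 1.
  set F : ℕ → ℝ → ℂ := fun j s => hankelWeight φ x₀ s * cexp (κ * hankelPath φ x₀ s) *
    ((-u * cexp (κ * hankelPath φ x₀ s)) ^ j / (j.factorial : ℂ)) with hF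
  set bd : ℕ → ℝ → ℝ := fun j s => ‖hankelWeight φ x₀ s‖ * Real.exp (κ * hankelRe φ x₀ s) *
    ((|u| * Real.exp (κ * hankelRe φ x₀ s)) ^ j / (j.factorial : ℝ)) with hbd
  have hbs : ∀ s, HasSum (fun j => bd j s) (‖hankelWeight φ x₀ s‖ *
      Real.exp (|u| * Real.exp (κ * hankelRe φ x₀ s) + κ * hankelRe φ x₀ s)) := fun s => by
    have := (NormedSpace.expSeries_div_hasSum_exp (|u| * Real.exp (κ * hankelRe φ x₀ s))).mul_left
      (‖hankelWeight φ x₀ s‖ * Real.exp (κ * hankelRe φ x₀ s))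
    rw [← Real.exp_eq_exp_ℝ] at this
    convert! this using 1
    rw [Real.exp_add]; ring
  have hs := hasSum_integral_of_dominated_convergence (μ := volume.restrict (Ioi (0 : ℝ)))
    (F := F) (f := fun s => hankelWeight φ x₀ s *
      cexp (κ * hankelPath φ x₀ s) * cexp (-u * cexp (κ * hankelPath φ x₀ s))) bd
    (fun j => Measurable.aestronglyMeasurable (by fun_prop))
    (fun j => Eventually.of_forall fun s => by
      simp only [hF, hbd, norm_mul, norm_div, norm_pow, norm_cexp_mul_hankelPath, norm_neg,
        norm_real, Real.norm_eq_abs, norm_natCast, le_refl])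
    (Eventually.of_forall fun s => (hbs s).summable)
    (by
      simp_rw [fun s => (hbs s).tsum_eq]
      exact integrableOn_hankelWeight_mul h1 h2 hκ1 |u| κ x₀)
    (Eventually.of_forall fun s => by
      have := (NormedSpace.expSeries_div_hasSum_exp
        (-u * cexp (κ * hankelPath φ x₀ s))).mul_left
        (hankelWeight φ x₀ s * cexp (κ * hankelPath φ x₀ s))
      rwa [← Complex.exp_eq_exp_ℂ] at this)
  have hterm : ∀ j : ℕ, (∫ s in Ioi 0, F j s).im =
      (-u) ^ j / (j.factorial : ℝ) * (Real.pi / Real.Gamma (1 - κ * (j + 1 : ℕ))) := by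
    intro j
    rw [← im_integral_hankelWeight_mul_cexp h1 h2 _ x₀, ← im_ofReal_mul, ← integral_const_mul]
    congr 2
    ext s
    simp only [hF]
    have e : cexp (((1 - (1 - κ * (j + 1 : ℕ)) : ℝ) : ℂ) * hankelPath φ x₀ s) =
        cexp (κ * hankelPath φ x₀ s) * cexp (κ * hankelPath φ x₀ s) ^ j := by
      rw [← Complex.exp_nat_mul, ← Complex.exp_add]; congr 1; push_cast; ring
    rw [e, mul_pow]; push_cast; ring
  have him := (Complex.hasSum_im hs)
  simp_rw [hterm] at him
  rw [mlDensity, ← tsum_mul_left]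
  simp_rw [mlDensity_term hκ0]
  rw [tsum_mul_left, him.tsum_eq]

end FracPoisson

/-! ### Decay, continuity and moments of the Mittag-Leffler density -/

namespace FracPoisson

open Filter Topology Complex

lemma integrableOn_pow_mul_exp_neg {a : ℝ} (ha : 0 < a) (n : ℕ) :
    IntegrableOn (fun u : ℝ => u ^ n * Real.exp (-a * u)) (Ioi 0) := by
  simpa using integrableOn_rpow_mul_exp_neg_mul_rpow (s := n) (p := 1)
    (by linarith [n.cast_nonneg (α := ℝ)]) zero_lt_one ha

lemma integrableOn_pow_mul_cexp_neg {r : ℂ} (hr : 0 < r.re) (n : ℕ) :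
    IntegrableOn (fun u : ℝ => (u : ℂ) ^ n * cexp (-u * r)) (Ioi 0) := by
  refine Integrable.mono' (integrableOn_pow_mul_exp_neg hr n)
    (Measurable.aestronglyMeasurable (by fun_prop)) ?_
  filter_upwards [ae_restrict_mem measurableSet_Ioi] with u hu
  rw [norm_mul, norm_pow, norm_real, Real.norm_of_nonneg (le_of_lt hu), Complex.norm_exp]
  simp [mul_comm]

lemma integral_pow_mul_cexp_neg {r : ℂ} (hr : 0 < r.re) (n : ℕ) :
    ∫ u : ℝ in Ioi 0, (u : ℂ) ^ n * cexp (-u * r) = n.factorial / r ^ (n + 1) := by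
  have hr0 : r ≠ 0 := by rintro rfl; simp at hr
  induction n with
  | zero =>
    have := integral_exp_mul_complex_Ioi (a := -r) (by simpa using hr) 0
    simp only [pow_zero, one_mul, Nat.factorial_zero, Nat.cast_one, zero_add, pow_one]
    simp only [neg_mul, ofReal_zero, mul_zero, Complex.exp_zero, neg_div_neg_eq] at this
    rw [← this]
    congr 1; ext u; ring_nf
  | succ n ih =>
    have hd : ∀ u ∈ Ici (0 : ℝ), HasDerivAt (fun u : ℝ => (u : ℂ) ^ (n + 1) * cexp (-u * r))
        ((n + 1) * ((u : ℂ) ^ n * cexp (-u * r)) - r * ((u : ℂ) ^ (n + 1) * cexp (-u * r))) u := by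
      intro u _
      have h1 : HasDerivAt (fun u : ℂ => u ^ (n + 1) * cexp (-u * r))
          (((n + 1 : ℕ) * u ^ n) * cexp (-u * r) + u ^ (n + 1) * (cexp (-u * r) * (-1 * r)))
          (u : ℂ) :=
        (hasDerivAt_pow (n + 1) (u : ℂ)).mul (((hasDerivAt_neg (u : ℂ)).mul_const r).cexp)
      convert! h1.comp_ofReal using 1
      push_cast; ring
    have i1 := (integrableOn_pow_mul_cexp_neg hr n).const_mul (n + 1 : ℂ)
    have i2 := (integrableOn_pow_mul_cexp_neg hr (n + 1)).const_mul r
    have hlim : Tendsto (fun u : ℝ => (u : ℂ) ^ (n + 1) * cexp (-u * r)) atTop (𝓝 0) := by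
      rw [tendsto_zero_iff_norm_tendsto_zero]
      have := (tendsto_rpow_mul_exp_neg_mul_atTop_nhds_zero (n + 1 : ℕ) r.re hr)
      refine this.congr' ?_
      filter_upwards [eventually_ge_atTop 0] with u hu
      rw [norm_mul, norm_pow, norm_real, Real.norm_of_nonneg hu, Complex.norm_exp,
        Real.rpow_natCast]
      simp [mul_comm]
    have h := integral_Ioi_of_hasDerivAt_of_tendsto' hd (i1.sub i2) hlim
    rw [integral_sub i1 i2, integral_const_mul, integral_const_mul, ih] at h
    simp only [ofReal_zero, ne_eq, Nat.succ_ne_zero, not_false_eq_true, zero_pow, zero_mul,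
      sub_zero] at h
    rw [Nat.factorial_succ]
    push_cast
    field_simp at h ⊢
    linear_combination -h

/-- An opening angle for which both `exp σ` and `exp (-u σ ^ κ)` decay along the rays of Hankel's
contour. -/
noncomputable def hankelAngle (κ : ℝ) : ℝ := Real.pi / (1 + κ)

lemma pi_div_two_lt_hankelAngle {κ : ℝ} (hκ0 : 0 < κ) (hκ1 : κ < 1) :
    Real.pi / 2 < hankelAngle κ := by
  unfold hankelAngle; gcongr; linarith

lemma hankelAngle_le_pi {κ : ℝ} (hκ0 : 0 < κ) : hankelAngle κ ≤ Real.pi :=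
  div_le_self Real.pi_pos.le (by linarith)

/-- Since `2κ < 1 + κ`, the angle `κπ / (1 + κ)` is below `π / 2`. -/
lemma cos_mul_hankelAngle_pos {κ : ℝ} (hκ0 : 0 < κ) (hκ1 : κ < 1) :
    0 < Real.cos (κ * hankelAngle κ) := by
  have hpi := Real.pi_pos
  have h1 : 0 < hankelAngle κ := (by positivity : 0 < Real.pi / 2).trans
    (pi_div_two_lt_hankelAngle hκ0 hκ1)
  refine Real.cos_pos_of_mem_Ioo ⟨by nlinarith, ?_⟩
  rw [hankelAngle, ← mul_div_assoc, div_lt_div_iff₀ (by linarith) (by norm_num)]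
  nlinarith

/-- On the path `|σ| ≥ exp x₀` and `arg σ ^ κ` stays in `[0, κφ]`, below `π / 2`. The bound is
uniform in `s` and gives exponential decay in `u`. -/
lemma le_re_cexp_mul_hankelPath {κ s : ℝ} (hκ0 : 0 < κ) (hκ1 : κ < 1) (hs : 0 < s) (x₀ : ℝ) :
    Real.cos (κ * hankelAngle κ) * Real.exp (κ * x₀) ≤
      (cexp (κ * hankelPath (hankelAngle κ) x₀ s)).re := by
  have hφ : 0 < hankelAngle κ := (by positivity : 0 < Real.pi / 2).trans
    (pi_div_two_lt_hankelAngle hκ0 hκ1)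
  have hm : 0 ≤ min s (hankelAngle κ) := le_min hs.le hφ.le
  have hc := cos_mul_hankelAngle_pos hκ0 hκ1
  rw [Complex.exp_re, mul_comm (Real.cos _)]
  simp only [re_ofReal_mul, re_hankelPath, im_ofReal_mul, im_hankelPath]
  have h1 : Real.exp (κ * x₀) ≤ Real.exp (κ * hankelRe (hankelAngle κ) x₀ s) := by
    gcongr; exact le_hankelRe _ _ _
  have h2 : Real.cos (κ * hankelAngle κ) ≤ Real.cos (κ * min s (hankelAngle κ)) := by
    refine Real.cos_le_cos_of_nonneg_of_le_pi (by positivity) ?_ ?_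
    · have := hankelAngle_le_pi hκ0
      nlinarith [Real.pi_pos]
    · gcongr; exact min_le_right _ _
  gcongr

/-- The integrand in the representation of `mlDensity κ u`. -/
noncomputable def mlIntegrand (κ x₀ u s : ℝ) : ℂ :=
  hankelWeight (hankelAngle κ) x₀ s * cexp (κ * hankelPath (hankelAngle κ) x₀ s) *
    cexp (-u * cexp (κ * hankelPath (hankelAngle κ) x₀ s))

@[fun_prop]
lemma measurable_uncurry_mlIntegrand (κ x₀ : ℝ) :
    Measurable fun p : ℝ × ℝ => mlIntegrand κ x₀ p.1 p.2 := by
  unfold mlIntegrand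
  have := measurable_hankelWeight (hankelAngle κ) x₀
  fun_prop

lemma norm_mlIntegrand_le {κ u s : ℝ} (hκ0 : 0 < κ) (hκ1 : κ < 1) (hs : 0 < s) (hu : 0 ≤ u)
    (x₀ : ℝ) :
    ‖mlIntegrand κ x₀ u s‖ ≤ Real.exp (-(Real.cos (κ * hankelAngle κ) * Real.exp (κ * x₀)) * u) *
      ‖hankelWeight (hankelAngle κ) x₀ s * cexp (κ * hankelPath (hankelAngle κ) x₀ s)‖ := by
  rw [mlIntegrand, norm_mul, mul_comm]
  gcongr
  rw [Complex.norm_exp]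
  refine Real.exp_le_exp.2 ?_
  have := mul_le_mul_of_nonneg_left (le_re_cexp_mul_hankelPath hκ0 hκ1 hs x₀) hu
  rw [← ofReal_neg, re_ofReal_mul]
  linarith

lemma mlDensity_eq_integral_mlIntegrand {κ : ℝ} (hκ0 : 0 < κ) (hκ1 : κ < 1) (x₀ u : ℝ) :
    mlDensity κ u = 1 / Real.pi * (∫ s in Ioi 0, mlIntegrand κ x₀ u s).im :=
  mlDensity_eq_integral (pi_div_two_lt_hankelAngle hκ0 hκ1) (hankelAngle_le_pi hκ0) hκ0 hκ1 x₀ u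

lemma integrableOn_hankelWeight_angle {κ : ℝ} (hκ0 : 0 < κ) (hκ1 : κ < 1) (x₀ : ℝ) :
    IntegrableOn (fun s => hankelWeight (hankelAngle κ) x₀ s *
      cexp (κ * hankelPath (hankelAngle κ) x₀ s)) (Ioi 0) :=
  integrableOn_hankelWeight_mul_cexp (pi_div_two_lt_hankelAngle hκ0 hκ1) (hankelAngle_le_pi hκ0)
    κ x₀

/-- The density of the Mittag-Leffler distribution decays faster than every exponential. -/
lemma exists_abs_mlDensity_le {κ : ℝ} (hκ0 : 0 < κ) (hκ1 : κ < 1) (a : ℝ) :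
    ∃ C : ℝ, ∀ u, 0 ≤ u → |mlDensity κ u| ≤ C * Real.exp (-a * u) := by
  have hc := cos_mul_hankelAngle_pos hκ0 hκ1
  -- The representation of the density holds for every `x₀`, so a large radius produces any decay
  -- rate.
  obtain ⟨x₀, hx₀⟩ : ∃ x₀ : ℝ, a ≤ Real.cos (κ * hankelAngle κ) * Real.exp (κ * x₀) := by
    have : Tendsto (fun x : ℝ => Real.cos (κ * hankelAngle κ) * Real.exp (κ * x)) atTop atTop :=
      (Real.tendsto_exp_atTop.comp (tendsto_id.const_mul_atTop hκ0)).const_mul_atTop hc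
    exact (this.eventually_ge_atTop a).exists
  refine ⟨1 / Real.pi * ∫ s in Ioi 0, ‖hankelWeight (hankelAngle κ) x₀ s *
      cexp (κ * hankelPath (hankelAngle κ) x₀ s)‖, fun u hu => ?_⟩
  rw [mlDensity_eq_integral_mlIntegrand hκ0 hκ1 x₀, abs_mul,
    abs_of_pos (by have := Real.pi_pos; positivity), mul_assoc]
  refine mul_le_mul_of_nonneg_left ?_ (by have := Real.pi_pos; positivity)
  refine (Complex.abs_im_le_norm _).trans ?_
  rw [← integral_mul_const]
  refine norm_integral_le_of_norm_le
    ((integrableOn_hankelWeight_angle hκ0 hκ1 x₀).norm.mul_const _) ?_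
  filter_upwards [ae_restrict_mem measurableSet_Ioi] with s hs
  refine (norm_mlIntegrand_le hκ0 hκ1 hs hu x₀).trans ?_
  rw [mul_comm]
  gcongr

lemma continuousOn_mlDensity {κ : ℝ} (hκ0 : 0 < κ) (hκ1 : κ < 1) :
    ContinuousOn (mlDensity κ) (Ici 0) := by
  have h : ContinuousOn (fun u => ∫ s in Ioi 0, mlIntegrand κ 0 u s) (Ici 0) := by
    refine continuousOn_of_dominated (fun u _ => ?_) (fun u hu => ?_)
      (integrableOn_hankelWeight_angle hκ0 hκ1 0).norm (Eventually.of_forall fun s => ?_)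
    · exact ((measurable_uncurry_mlIntegrand κ 0).comp
        (measurable_const.prodMk measurable_id)).aestronglyMeasurable
    · filter_upwards [ae_restrict_mem measurableSet_Ioi] with s hs
      refine (norm_mlIntegrand_le hκ0 hκ1 hs hu 0).trans
        (mul_le_of_le_one_left (norm_nonneg _) (Real.exp_le_one_iff.2 ?_))
      have := cos_mul_hankelAngle_pos hκ0 hκ1
      have : 0 ≤ Real.cos (κ * hankelAngle κ) * Real.exp (κ * 0) := by positivity
      have hu : 0 ≤ u := hu
      nlinarith
    · unfold mlIntegrand
      fun_prop
  refine ContinuousOn.congr (f := fun u => 1 / Real.pi * (∫ s in Ioi 0, mlIntegrand κ 0 u s).im)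
    ?_ fun u _ => mlDensity_eq_integral_mlIntegrand hκ0 hκ1 0 u
  exact (Complex.continuous_im.comp_continuousOn h).const_mul _

/-- The moments of the density of the Mittag-Leffler distribution. -/
lemma integral_pow_mul_mlDensity {κ : ℝ} (hκ0 : 0 < κ) (hκ1 : κ < 1) (n : ℕ) :
    ∫ u in Ioi 0, u ^ n * mlDensity κ u = n.factorial / Real.Gamma (κ * n + 1) := by
  have h1 := pi_div_two_lt_hankelAngle hκ0 hκ1
  have h2 := hankelAngle_le_pi hκ0
  have hc := cos_mul_hankelAngle_pos hκ0 hκ1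
  set c := Real.cos (κ * hankelAngle κ) * Real.exp (κ * 0) with hcdef
  have hc0 : 0 < c := by positivity
  set μ := volume.restrict (Ioi (0 : ℝ)) with hμ
  have hint : Integrable (Function.uncurry fun u s : ℝ => (u : ℂ) ^ n * mlIntegrand κ 0 u s)
      (μ.prod μ) := by
    refine Integrable.mono' ((integrableOn_pow_mul_exp_neg hc0 n).mul_prod
      (integrableOn_hankelWeight_angle hκ0 hκ1 0).norm)
      (Measurable.aestronglyMeasurable ?_) ?_
    · have := measurable_uncurry_mlIntegrand κ 0
      simp only [Function.uncurry_def]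
      fun_prop
    · rw [hμ, Measure.prod_restrict]
      filter_upwards [ae_restrict_mem (measurableSet_Ioi.prod measurableSet_Ioi)] with p hp
      have hp1 : 0 < p.1 := hp.1
      have := norm_mlIntegrand_le hκ0 hκ1 hp.2 hp1.le 0
      simp only [Function.uncurry_def, norm_mul (_ ^ n), norm_pow, norm_real,
        Real.norm_of_nonneg hp1.le, mul_assoc (p.1 ^ n)]
      gcongr
  have e1 : ∀ u : ℝ, u ^ n * mlDensity κ u =
      1 / Real.pi * (∫ s, (u : ℂ) ^ n * mlIntegrand κ 0 u s ∂μ).im := fun u => by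
    rw [mlDensity_eq_integral_mlIntegrand hκ0 hκ1 0, integral_const_mul, ← ofReal_pow,
      im_ofReal_mul]
    ring
  simp_rw [e1]
  rw [integral_const_mul]
  have e2 : ∫ u, (∫ s, (u : ℂ) ^ n * mlIntegrand κ 0 u s ∂μ).im ∂μ =
      (∫ u, ∫ s, (u : ℂ) ^ n * mlIntegrand κ 0 u s ∂μ ∂μ).im :=
    integral_im hint.integral_prod_left
  rw [e2, integral_integral_swap hint]
  -- With `r = σ ^ κ`, the inner integral is `n! / r ^ (n + 1)`. One factor `r` cancels, leaving the
  -- weight times `r ^ (-n)`: Hankel's integral at `z = κn + 1`.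
  have e3 : ∫ s, ∫ u, (u : ℂ) ^ n * mlIntegrand κ 0 u s ∂μ ∂μ =
      (n.factorial : ℝ) * ∫ s in Ioi 0, hankelWeight (hankelAngle κ) 0 s *
        cexp ((1 - (κ * n + 1) : ℝ) * hankelPath (hankelAngle κ) 0 s) := by
    rw [← integral_const_mul]
    refine setIntegral_congr_fun measurableSet_Ioi fun s hs => ?_
    set r := cexp (κ * hankelPath (hankelAngle κ) 0 s) with hr
    have hr0 : 0 < r.re := hc0.trans_le (le_re_cexp_mul_hankelPath hκ0 hκ1 hs 0)
    have e4 : ∀ u : ℝ, (u : ℂ) ^ n * mlIntegrand κ 0 u s =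
        (hankelWeight (hankelAngle κ) 0 s * r) * ((u : ℂ) ^ n * cexp (-u * r)) := fun u => by
      rw [mlIntegrand]; ring
    simp_rw [e4]
    rw [integral_const_mul, integral_pow_mul_cexp_neg hr0]
    have e5 : cexp (((1 - (κ * n + 1) : ℝ) : ℂ) * hankelPath (hankelAngle κ) 0 s) =
        (r ^ n)⁻¹ := by
      rw [hr, ← Complex.exp_nat_mul, ← Complex.exp_neg]; congr 1; push_cast; ring
    have : r ≠ 0 := Complex.exp_ne_zero _
    rw [e5]; push_cast; field_simp; ring
  rw [e3, im_ofReal_mul, im_integral_hankelWeight_mul_cexp h1 h2]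
  have := Real.pi_ne_zero
  field_simp

end FracPoisson

/-! ### Fractional powers and the series of the counting probabilities -/

namespace FracPoisson

open Filter Topology

/-- The fractional power `t ^ b / Γ(b + 1)`. -/
noncomputable def fracPow (b t : ℝ) : ℝ := t ^ b / Real.Gamma (b + 1)

@[fun_prop]
lemma measurable_fracPow (b : ℝ) : Measurable (fracPow b) := by
  unfold fracPow; fun_prop

lemma fracPow_nonneg {b t : ℝ} (hb : 0 ≤ b) (ht : 0 ≤ t) : 0 ≤ fracPow b t :=
  div_nonneg (Real.rpow_nonneg ht b) (Real.Gamma_pos_of_pos (by linarith)).le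

lemma fracPow_le_fracPow {b s t : ℝ} (hb : 0 ≤ b) (hs : 0 ≤ s) (hst : s ≤ t) :
    fracPow b s ≤ fracPow b t :=
  div_le_div_of_nonneg_right (Real.rpow_le_rpow hs hst hb) (Real.Gamma_pos_of_pos (by linarith)).le

lemma fracPow_zero_left (t : ℝ) : fracPow 0 t = 1 := by simp [fracPow]

lemma fracPow_zero_right {b : ℝ} (hb : b ≠ 0) : fracPow b 0 = 0 := by
  simp [fracPow, Real.zero_rpow hb]

lemma pow_mul_fracPow {κ t : ℝ} (ht : 0 ≤ t) (R : ℝ) (j : ℕ) :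
    R ^ j * fracPow (κ * j) t = (R * t ^ κ) ^ j / Real.Gamma (κ * j + 1) := by
  rw [fracPow, Real.rpow_mul ht, Real.rpow_natCast, mul_pow, mul_div_assoc]

lemma exists_pow_mul_fracPow_le {κ R t : ℝ} (hκ : 0 < κ) (hR : 0 ≤ R) (ht : 0 ≤ t) :
    ∃ C : ℝ, ∀ j : ℕ, R ^ j * fracPow (κ * j) t ≤ C * (1 / 2) ^ j := by
  obtain ⟨C, hC⟩ := exists_pow_div_Gamma_le hκ le_rfl (mul_nonneg hR (Real.rpow_nonneg ht κ))
  refine ⟨C, fun j => ?_⟩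
  rw [pow_mul_fracPow ht]
  simpa using hC j

lemma summable_pow_mul_fracPow {κ R t : ℝ} (hκ : 0 < κ) (hR : 0 ≤ R) (ht : 0 ≤ t) :
    Summable fun j : ℕ => R ^ j * fracPow (κ * j) t := by
  simp_rw [pow_mul_fracPow ht]
  simpa using summable_pow_div_Gamma hκ le_rfl (mul_nonneg hR (Real.rpow_nonneg ht κ))

lemma integral_rpow_mul_rpow_sub {a b t : ℝ} (ha : 0 < a) (hb : 0 < b) (ht : 0 < t) :
    ∫ v in (0 : ℝ)..t, v ^ (a - 1) * (t - v) ^ (b - 1) =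
      t ^ (a + b - 1) * (Real.Gamma a * Real.Gamma b / Real.Gamma (a + b)) := by
  have h := Complex.betaIntegral_scaled a b ht
  have hβ : Complex.betaIntegral a b = (beta a b : ℝ) := by
    rw [Complex.betaIntegral_eq_Gamma_mul_div _ _ (by simpa) (by simpa), beta]
    push_cast [← Complex.Gamma_ofReal]
    rfl
  have e : ∀ v ∈ Set.uIcc 0 t, (v : ℂ) ^ ((a : ℂ) - 1) * ((t : ℂ) - v) ^ ((b : ℂ) - 1) =
      ((v ^ (a - 1) * (t - v) ^ (b - 1) : ℝ) : ℂ) := by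
    intro v hv
    rw [uIcc_of_le ht.le] at hv
    rw [Complex.ofReal_mul, Complex.ofReal_cpow hv.1, Complex.ofReal_cpow (sub_nonneg.2 hv.2)]
    push_cast; rfl
  have e2 : (t : ℂ) ^ ((a : ℂ) + b - 1) = ((t ^ (a + b - 1) : ℝ) : ℂ) := by
    rw [Complex.ofReal_cpow ht.le]; push_cast; rfl
  rw [intervalIntegral.integral_congr e, intervalIntegral.integral_ofReal, hβ, e2] at h
  exact_mod_cast h

/-- The Beta integral; the factor `b v ^ (b - 1) / Γ(b + 1)` is the derivative of `fracPow b`. -/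
lemma mul_integral_fracPow_sub_mul_rpow {a b t : ℝ} (ha : 0 < a) (hb : 0 < b) (ht : 0 < t) :
    b / Real.Gamma (b + 1) * ∫ v in Ioc 0 t, fracPow a (t - v) * v ^ (b - 1) =
      fracPow (b + a) t := by
  have h := integral_rpow_mul_rpow_sub hb (show 0 < a + 1 by linarith) ht
  rw [intervalIntegral.integral_of_le ht.le] at h
  have e : ∀ v, fracPow a (t - v) * v ^ (b - 1) =
      (1 / Real.Gamma (a + 1)) * (v ^ (b - 1) * (t - v) ^ (a + 1 - 1)) := fun v => by
    rw [fracPow, add_sub_cancel_right]; ring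
  simp_rw [e]
  rw [integral_const_mul, h, Real.Gamma_add_one hb.ne', fracPow, ← add_assoc,
    add_sub_cancel_right]
  have h1 := (Real.Gamma_pos_of_pos hb).ne'
  have h2 := (Real.Gamma_pos_of_pos (show 0 < a + 1 by linarith)).ne'
  have h3 := (Real.Gamma_pos_of_pos (show 0 < b + a + 1 by linarith)).ne'
  field_simp

/-- Layer-cake formula for `max (t - x) 0`. It replaces integration against `ρ` by integration of
its distribution function, whose series is known. -/
lemma integral_rpow_sub_eq {ρ : Measure ℝ} [IsProbabilityMeasure ρ] (h0 : ρ (Iio 0) = 0)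
    {b : ℝ} (hb : 0 < b) (t : ℝ) :
    ∫ x in Iic t, (t - x) ^ b ∂ρ = b * ∫ v in Ioc 0 t, ρ.real (Iic (t - v)) * v ^ (b - 1) := by
  have hanti : Antitone fun v : ℝ => ρ.real (Iic (t - v)) := fun v w hvw =>
    measureReal_mono (Iic_subset_Iic.2 (by linarith))
  have hlc := lintegral_rpow_eq_lintegral_meas_le_mul ρ (f := fun x => max (t - x) 0)
    (Eventually.of_forall fun x => le_max_right _ _) (by fun_prop) hb
  have e1 : ∫⁻ x, ENNReal.ofReal (max (t - x) 0 ^ b) ∂ρ =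
      ∫⁻ x in Iic t, ENNReal.ofReal ((t - x) ^ b) ∂ρ := by
    rw [← lintegral_indicator measurableSet_Iic]
    refine lintegral_congr fun x => ?_
    by_cases hx : x ≤ t
    · rw [indicator_of_mem (show x ∈ Iic t from hx), max_eq_left (by linarith)]
    · rw [indicator_of_notMem (show x ∉ Iic t from hx), max_eq_right (by linarith),
        Real.zero_rpow hb.ne', ENNReal.ofReal_zero]
  have e2 : ∫⁻ v in Ioi 0, ρ {x | v ≤ max (t - x) 0} * ENNReal.ofReal (v ^ (b - 1)) =
      ∫⁻ v in Ioc 0 t, ENNReal.ofReal (ρ.real (Iic (t - v)) * v ^ (b - 1)) := by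
    rw [← lintegral_indicator measurableSet_Ioi, ← lintegral_indicator measurableSet_Ioc]
    refine lintegral_congr fun v => ?_
    by_cases hv : 0 < v
    · have es : {x : ℝ | v ≤ max (t - x) 0} = Iic (t - v) := by
        ext x
        simp only [mem_ofPred_eq, le_max_iff, mem_Iic]
        constructor
        · rintro (h | h) <;> linarith
        · intro h; left; linarith
      rw [indicator_of_mem (show v ∈ Ioi (0 : ℝ) from hv), es]
      by_cases hvt : v ≤ t
      · rw [indicator_of_mem (show v ∈ Ioc 0 t from ⟨hv, hvt⟩),
          ENNReal.ofReal_mul measureReal_nonneg, ofReal_measureReal]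
      · rw [indicator_of_notMem (fun h : v ∈ Ioc 0 t => hvt h.2),
          measure_mono_null (Iic_subset_Iio.2 (by linarith)) h0, zero_mul]
    · rw [indicator_of_notMem (show v ∉ Ioi (0 : ℝ) from hv),
        indicator_of_notMem (fun h : v ∈ Ioc 0 t => hv h.1)]
  rw [integral_eq_lintegral_of_nonneg_ae, integral_eq_lintegral_of_nonneg_ae, ← e1, hlc, e2,
    ENNReal.toReal_mul, ENNReal.toReal_ofReal hb.le]
  · filter_upwards [ae_restrict_mem measurableSet_Ioc] with v hv
    exact mul_nonneg measureReal_nonneg (Real.rpow_nonneg hv.1.le _)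
  · exact (hanti.measurable.mul (by fun_prop)).aestronglyMeasurable
  · filter_upwards [ae_restrict_mem measurableSet_Iic] with x hx
    exact Real.rpow_nonneg (sub_nonneg.2 hx) _
  · exact Measurable.aestronglyMeasurable (by fun_prop)

/-- Convolving a fractional power with the law of a Mittag-Leffler waiting time. -/
lemma hasSum_integral_fracPow_sub {ν κ : ℝ} (hν : 0 < ν) (hκ : 0 < κ) {ρ : Measure ℝ}
    [IsProbabilityMeasure ρ] (h0 : ρ (Iic 0) = 0)
    (hρ : ∀ t, 0 ≤ t → HasSum (fun k : ℕ => (-1) ^ k * ν ^ (k + 1) * fracPow (κ * (k + 1 : ℕ)) t)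
      (ρ.real (Iic t))) {b t : ℝ} (hb : 0 ≤ b) (ht : 0 ≤ t) :
    HasSum (fun k : ℕ => (-1) ^ k * ν ^ (k + 1) * fracPow (b + κ * (k + 1 : ℕ)) t)
      (∫ x in Iic t, fracPow b (t - x) ∂ρ) := by
  rcases hb.eq_or_lt with rfl | hb
  · simpa [fracPow_zero_left] using hρ t ht
  rcases ht.eq_or_lt with rfl | ht
  · have e : ∀ k : ℕ, fracPow (b + κ * (k + 1 : ℕ)) 0 = 0 := fun k =>
      fracPow_zero_right (by positivity)
    simp only [e, mul_zero, Measure.restrict_eq_zero.2 h0, integral_zero_measure]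
    exact hasSum_zero
  have e0 : ∫ x in Iic t, fracPow b (t - x) ∂ρ =
      b / Real.Gamma (b + 1) * ∫ v in Ioc 0 t, ρ.real (Iic (t - v)) * v ^ (b - 1) := by
    simp only [fracPow]
    rw [integral_div, integral_rpow_sub_eq (measure_mono_null Iio_subset_Iic_self h0) hb t]
    ring
  have hsum := (summable_nat_add_iff 1).2 (summable_pow_mul_fracPow hκ hν.le ht.le)
  have hs := hasSum_integral_of_dominated_convergence (μ := volume.restrict (Ioc 0 t))
    (F := fun (k : ℕ) v => (-1) ^ k * ν ^ (k + 1) * fracPow (κ * (k + 1 : ℕ)) (t - v) *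
      v ^ (b - 1))
    (f := fun v => ρ.real (Iic (t - v)) * v ^ (b - 1))
    (fun (k : ℕ) v => ν ^ (k + 1) * fracPow (κ * (k + 1 : ℕ)) t * v ^ (b - 1))
    (fun k => Measurable.aestronglyMeasurable (by fun_prop))
    (fun k => by
      filter_upwards [ae_restrict_mem measurableSet_Ioc] with v hv
      have h1 := fracPow_nonneg (b := κ * (k + 1 : ℕ)) (by positivity) (sub_nonneg.2 hv.2)
      have h2 := fracPow_le_fracPow (b := κ * (k + 1 : ℕ)) (by positivity) (sub_nonneg.2 hv.2)
        (show t - v ≤ t by linarith [hv.1])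
      have h3 : 0 ≤ v ^ (b - 1) := Real.rpow_nonneg hv.1.le _
      rw [norm_mul, norm_mul, norm_mul, norm_pow, norm_neg, norm_one, one_pow, one_mul,
        Real.norm_of_nonneg h1, Real.norm_of_nonneg h3,
        Real.norm_of_nonneg (show 0 ≤ ν ^ (k + 1) by positivity)]
      gcongr)
    (Eventually.of_forall fun v => hsum.mul_right _)
    (by
      simp_rw [tsum_mul_right]
      refine Integrable.const_mul ?_ _
      exact (intervalIntegrable_iff_integrableOn_Ioc_of_le ht.le).1
        (intervalIntegral.intervalIntegrable_rpow' (by linarith)))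
    (by
      filter_upwards [ae_restrict_mem measurableSet_Ioc] with v hv
      exact (hρ _ (sub_nonneg.2 hv.2)).mul_right _)
  rw [e0]
  convert! hs.mul_left (b / Real.Gamma (b + 1)) using 1
  ext k
  rw [← mul_integral_fracPow_sub_mul_rpow (a := κ * (k + 1 : ℕ)) (by positivity) hb ht]
  simp_rw [mul_assoc _ (fracPow _ _)]
  rw [integral_const_mul]
  ring

/-- The `j`-th term of the series for the probability that the fractional Poisson process has
exactly `n` jumps up to time `t`. -/
noncomputable def fppTerm (ν κ : ℝ) (n : ℕ) (t : ℝ) (j : ℕ) : ℝ :=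
  (-1) ^ (j + n) * (j.choose n : ℝ) * ν ^ j * fracPow (κ * j) t

/-- The probability that the fractional Poisson process has exactly `n` jumps up to time `t`. -/
noncomputable def fppProb (ν κ : ℝ) (n : ℕ) (t : ℝ) : ℝ := ∑' j, fppTerm ν κ n t j

lemma abs_fppTerm_le {ν κ t : ℝ} (hν : 0 < ν) (hκ : 0 < κ) (ht : 0 ≤ t) (n j : ℕ) :
    |fppTerm ν κ n t j| ≤ (2 * ν) ^ j * fracPow (κ * j) t := by
  have h1 := fracPow_nonneg (b := κ * j) (by positivity) ht
  rw [fppTerm, abs_mul, abs_mul, abs_mul, abs_pow, abs_neg, abs_one, one_pow, one_mul,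
    abs_of_nonneg h1, abs_of_nonneg (Nat.cast_nonneg _), abs_of_pos (pow_pos hν j), mul_pow]
  gcongr
  exact_mod_cast Nat.choose_le_two_pow j n

lemma hasSum_fppTerm {ν κ t : ℝ} (hν : 0 < ν) (hκ : 0 < κ) (ht : 0 ≤ t) (n : ℕ) :
    HasSum (fppTerm ν κ n t) (fppProb ν κ n t) :=
  (Summable.of_norm_bounded (summable_pow_mul_fracPow hκ (by positivity) ht)
    (abs_fppTerm_le hν hκ ht n)).hasSum

lemma sum_range_choose_right (n m : ℕ) :
    ∑ j ∈ Finset.range (m + 1), j.choose n = (m + 1).choose (n + 1) := by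
  induction m with
  | zero => cases n <;> simp [Nat.choose]
  | succ m ih => rw [Finset.sum_range_succ, ih, Nat.choose_succ_succ (m + 1), add_comm]

/-- Integrating termwise gives an absolutely convergent double series. Summed along antidiagonals,
its coefficients combine by the hockey-stick identity `sum_range_choose_right`. -/
lemma integral_fppProb_sub {ν κ : ℝ} (hν : 0 < ν) (hκ : 0 < κ) {ρ : Measure ℝ}
    [IsProbabilityMeasure ρ] (h0 : ρ (Iic 0) = 0)
    (hρ : ∀ t, 0 ≤ t → HasSum (fun k : ℕ => (-1) ^ k * ν ^ (k + 1) * fracPow (κ * (k + 1 : ℕ)) t)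
      (ρ.real (Iic t))) (n : ℕ) {t : ℝ} (ht : 0 ≤ t) :
    ∫ x in Iic t, fppProb ν κ n (t - x) ∂ρ = fppProb ν κ (n + 1) t := by
  have hpos : ∀ᵐ x ∂ρ, 0 < x := by
    rw [ae_iff]; simpa [Iic] using h0
  have hs := hasSum_integral_of_dominated_convergence (μ := ρ.restrict (Iic t))
    (F := fun (j : ℕ) x => fppTerm ν κ n (t - x) j) (f := fun x => fppProb ν κ n (t - x))
    (fun (j : ℕ) _ => (2 * ν) ^ j * fracPow (κ * j) t)
    (fun j => by unfold fppTerm; exact Measurable.aestronglyMeasurable (by fun_prop))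
    (fun j => by
      filter_upwards [ae_restrict_mem measurableSet_Iic, ae_restrict_of_ae hpos] with x hx hx0
      refine (abs_fppTerm_le hν hκ (sub_nonneg.2 hx) n j).trans ?_
      have := fracPow_le_fracPow (b := κ * j) (by positivity) (sub_nonneg.2 hx)
        (show t - x ≤ t by linarith)
      gcongr)
    (Eventually.of_forall fun x => summable_pow_mul_fracPow hκ (by positivity) ht)
    (integrable_const _)
    (by
      filter_upwards [ae_restrict_mem measurableSet_Iic] with x hx
      exact hasSum_fppTerm hν hκ (sub_nonneg.2 hx) n)
  set f : ℕ × ℕ → ℝ := fun p => (-1) ^ (p.1 + n) * (p.1.choose n : ℝ) * ν ^ p.1 *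
    ((-1) ^ p.2 * ν ^ (p.2 + 1) * fracPow (κ * p.1 + κ * (p.2 + 1 : ℕ)) t) with hf
  have hfiber : ∀ j : ℕ, HasSum (fun k => f (j, k)) (∫ x in Iic t, fppTerm ν κ n (t - x) j ∂ρ) := by
    intro j
    simp only [fppTerm]
    rw [integral_const_mul]
    exact (hasSum_integral_fracPow_sub hν hκ h0 hρ (by positivity) ht).mul_left _
  have hfsum : Summable f := by
    obtain ⟨C, hC⟩ := exists_pow_mul_fracPow_le (R := 2 * ν) hκ (by positivity) ht
    have hg : Summable fun j : ℕ => (1 / 2 : ℝ) ^ j :=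
      summable_geometric_of_lt_one (by norm_num) (by norm_num)
    have hgg := (hg.mul_of_nonneg hg (fun _ => by positivity) (fun _ => by positivity)).mul_left
      (C * (1 / 2))
    refine Summable.of_norm_bounded hgg fun p => ?_
    have e : κ * p.1 + κ * (p.2 + 1 : ℕ) = κ * (p.1 + p.2 + 1 : ℕ) := by push_cast; ring
    have hp := fracPow_nonneg (b := κ * (p.1 + p.2 + 1 : ℕ)) (by positivity) ht
    rw [Real.norm_eq_abs, hf]
    simp only [e, abs_mul, abs_pow, abs_neg, abs_one, one_pow, one_mul, Nat.abs_cast,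
      abs_of_pos hν, abs_of_nonneg hp]
    calc (p.1.choose n : ℝ) * ν ^ p.1 * (ν ^ (p.2 + 1) * fracPow (κ * (p.1 + p.2 + 1 : ℕ)) t)
        ≤ 2 ^ (p.1 + p.2 + 1) * ν ^ p.1 *
          (ν ^ (p.2 + 1) * fracPow (κ * (p.1 + p.2 + 1 : ℕ)) t) := by
          gcongr
          calc (p.1.choose n : ℝ) ≤ 2 ^ p.1 := by exact_mod_cast Nat.choose_le_two_pow _ _
            _ ≤ _ := pow_le_pow_right₀ (by norm_num) (by omega)
      _ = (2 * ν) ^ (p.1 + p.2 + 1) * fracPow (κ * (p.1 + p.2 + 1 : ℕ)) t := by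
          rw [mul_pow]; ring
      _ ≤ C * (1 / 2) ^ (p.1 + p.2 + 1) := hC _
      _ = _ := by ring
  have h1 := hfsum.hasSum.prod_fiberwise hfiber
  have h2 := (Finset.HasAntidiagonal.sigmaAntidiagonalEquivProd.hasSum_iff.2 hfsum.hasSum).sigma
    (fun m => hasSum_fintype _)
  -- The index shifts to `m + 1` because the series of `ρ` starts with exponent κ; the missing term
  -- of index `0` vanishes, as `C(0, n + 1) = 0`.
  have h3 : ∀ m : ℕ, ∑ c : Finset.HasAntidiagonal.antidiagonal m,
      (f ∘ Finset.HasAntidiagonal.sigmaAntidiagonalEquivProd) ⟨m, c⟩ = fppTerm ν κ (n + 1) t (m + 1) := by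
    intro m
    simp only [Function.comp_apply, Finset.HasAntidiagonal.sigmaAntidiagonalEquivProd_apply]
    rw [Finset.sum_coe_sort (Finset.HasAntidiagonal.antidiagonal m) f,
      Finset.Nat.sum_antidiagonal_eq_sum_range_succ_mk, fppTerm, ← sum_range_choose_right n m]
    push_cast
    simp_rw [Finset.mul_sum, Finset.sum_mul]
    refine Finset.sum_congr rfl fun j hj => ?_
    have hjm : j ≤ m := Nat.lt_succ_iff.1 (Finset.mem_range.1 hj)
    obtain ⟨i, rfl⟩ := Nat.exists_eq_add_of_le hjm
    simp only [hf, add_tsub_cancel_left]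
    have e : κ * j + κ * (i + 1 : ℕ) = κ * ((j + i : ℕ) + 1) := by push_cast; ring
    rw [e]
    have e2 : (-1 : ℝ) ^ (j + i + 1 + (n + 1)) = (-1) ^ (j + n) * (-1) ^ i := by
      rw [← pow_add, show j + i + 1 + (n + 1) = j + n + i + 2 by ring, pow_add _ _ 2]; simp
    rw [e2]; push_cast; ring
  simp_rw [h3] at h2
  have h4 := (hasSum_nat_add_iff' 1).2 (hasSum_fppTerm hν hκ ht (n + 1))
  have h5 : fppTerm ν κ (n + 1) t 0 = 0 := by simp [fppTerm]
  rw [Finset.sum_range_one, h5, sub_zero] at h4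
  rw [hs.unique h1, h2.unique h4]

end FracPoisson

/-! ### The renewal process with Mittag-Leffler waiting times -/

namespace FracPoisson

open Filter Topology

lemma measureReal_add_le_eq_integral {Ω : Type*} [MeasurableSpace Ω] {P : Measure Ω}
    [IsProbabilityMeasure P] {X Y : Ω → ℝ} (hX : Measurable X) (hY : Measurable Y)
    (h : IndepFun X Y P) (t : ℝ) :
    P.real {ω | X ω + Y ω ≤ t} = ∫ y, P.real {ω | X ω ≤ t - y} ∂(P.map Y) := by
  have hs : MeasurableSet {p : ℝ × ℝ | p.1 + p.2 ≤ t} :=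
    measurableSet_le (by fun_prop) (by fun_prop)
  have hanti : Antitone fun y : ℝ => P {ω | X ω ≤ t - y} := fun y z hyz =>
    measure_mono fun ω (hω : X ω ≤ t - z) => show X ω ≤ t - y by linarith
  have e : P {ω | X ω + Y ω ≤ t} = ∫⁻ y, P {ω | X ω ≤ t - y} ∂(P.map Y) := by
    have h1 : P {ω | X ω + Y ω ≤ t} =
        (P.map fun ω => (X ω, Y ω)) {p : ℝ × ℝ | p.1 + p.2 ≤ t} :=
      (Measure.map_apply (hX.prodMk hY) hs).symm
    have := Measure.isProbabilityMeasure_map (μ := P) hX.aemeasurable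
    have := Measure.isProbabilityMeasure_map (μ := P) hY.aemeasurable
    rw [h1, (indepFun_iff_map_prod_eq_prod_map_map hX.aemeasurable hY.aemeasurable).1 h,
      Measure.prod_apply_symm hs]
    refine lintegral_congr fun y => ?_
    rw [Measure.map_apply hX (hs.preimage (by fun_prop))]
    congr 1
    ext ω
    simp only [mem_preimage, mem_ofPred_eq, le_sub_iff_add_le]
  rw [measureReal_def, e, ← integral_toReal hanti.measurable.aemeasurable
    (Eventually.of_forall fun _ => measure_lt_top _ _)]
  rfl

lemma jumpTime_succ {Ω : Type*} (Δ : ℕ → Ω → ℝ) (n : ℕ) (ω : Ω) :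
    jumpTime Δ (n + 1) ω = jumpTime Δ n ω + Δ n ω :=
  Finset.sum_range_succ _ _

lemma IsMLWaitingTimes.measurable_jumpTime {ν κ : ℝ} {Ω : Type*} [MeasurableSpace Ω]
    {Δ : ℕ → Ω → ℝ} {P : Measure Ω} (h : IsMLWaitingTimes ν κ Δ P) (n : ℕ) :
    Measurable (jumpTime Δ n) := by
  unfold jumpTime
  exact Finset.measurable_fun_sum _ fun k _ => h.measurable k

section Renewal

variable {ν κ : ℝ} {Ω : Type*} [MeasurableSpace Ω] {Δ : ℕ → Ω → ℝ} {P : Measure Ω}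
  [IsProbabilityMeasure P]

/-- The distribution function is given for `t > 0` only; its limit as `t` decreases to `0` is `1 -
E_κ(0) = 0`. -/
lemma IsMLWaitingTimes.measure_nonpos (h : IsMLWaitingTimes ν κ Δ P) (hκ : 0 < κ) (k : ℕ) :
    P {ω | Δ k ω ≤ 0} = 0 := by
  rw [← measureReal_eq_zero_iff]
  refine le_antisymm ?_ measureReal_nonneg
  obtain ⟨C, hC⟩ := abs_mittagLeffler_sub_one_le hκ
  have hlim : Tendsto (fun t : ℝ => |-ν * t ^ κ|) (𝓝[>] 0) (𝓝 0) := by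
    have : Continuous fun t : ℝ => |-ν * t ^ κ| :=
      ((Real.continuous_rpow_const hκ.le).const_mul _).abs
    simpa [Real.zero_rpow hκ.ne'] using (this.tendsto 0).mono_left nhdsWithin_le_nhds
  have hlim2 := hlim.const_mul C
  rw [mul_zero] at hlim2
  refine ge_of_tendsto hlim2 ?_
  filter_upwards [self_mem_nhdsWithin, hlim.eventually_le_const zero_lt_one] with t ht ht1
  have ht : 0 < t := ht
  calc P.real {ω | Δ k ω ≤ 0} ≤ P.real {ω | Δ k ω ≤ t} :=
        measureReal_mono fun ω (hω : Δ k ω ≤ 0) => show Δ k ω ≤ t by linarith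
    _ = 1 - mittagLeffler κ (-ν * t ^ κ) := h.cdf_eq k t ht
    _ ≤ _ := by
        have := hC _ ht1
        have := (abs_le.1 this).1
        linarith

lemma IsMLWaitingTimes.ae_pos (h : IsMLWaitingTimes ν κ Δ P) (hκ : 0 < κ) :
    ∀ᵐ ω ∂P, ∀ k, 0 < Δ k ω := by
  refine ae_all_iff.2 fun k => ?_
  rw [ae_iff]
  simpa using h.measure_nonpos hκ k

lemma IsMLWaitingTimes.map_Iic_zero (h : IsMLWaitingTimes ν κ Δ P) (hκ : 0 < κ) (k : ℕ) :
    (P.map (Δ k)) (Iic 0) = 0 := by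
  rw [Measure.map_apply (h.measurable k) measurableSet_Iic]
  exact h.measure_nonpos hκ k

lemma IsMLWaitingTimes.hasSum_map_Iic (h : IsMLWaitingTimes ν κ Δ P) (hκ : 0 < κ) (k : ℕ)
    {t : ℝ} (ht : 0 ≤ t) :
    HasSum (fun j : ℕ => (-1) ^ j * ν ^ (j + 1) * fracPow (κ * (j + 1 : ℕ)) t)
      ((P.map (Δ k)).real (Iic t)) := by
  rcases ht.eq_or_lt with rfl | ht
  · have e : ∀ j : ℕ, fracPow (κ * (j + 1 : ℕ)) 0 = 0 := fun j =>
      fracPow_zero_right (by positivity)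
    simp only [e, mul_zero, measureReal_def, h.map_Iic_zero hκ k, ENNReal.toReal_zero]
    exact hasSum_zero
  · rw [map_measureReal_apply (h.measurable k) measurableSet_Iic]
    have h1 := (hasSum_nat_add_iff' 1).2 (hasSum_mittagLeffler hκ (-ν * t ^ κ))
    simp only [Finset.range_one, Finset.sum_singleton, pow_zero, Nat.cast_zero, mul_zero, zero_add,
      Real.Gamma_one, div_one] at h1
    convert! h1.neg using 1
    · ext j
      rw [mul_assoc, pow_mul_fracPow ht.le, neg_mul, neg_pow (ν * t ^ κ), pow_succ]
      ring
    · rw [neg_sub]; exact h.cdf_eq k t ht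

lemma IsMLWaitingTimes.map_eq (h : IsMLWaitingTimes ν κ Δ P) (hκ : 0 < κ) (k l : ℕ) :
    P.map (Δ k) = P.map (Δ l) := by
  have := fun i => Measure.isProbabilityMeasure_map (μ := P) (h.measurable i).aemeasurable
  refine Measure.ext_of_Iic _ _ fun t => ?_
  rcases le_total t 0 with ht | ht
  · rw [measure_mono_null (Iic_subset_Iic.2 ht) (h.map_Iic_zero hκ k),
      measure_mono_null (Iic_subset_Iic.2 ht) (h.map_Iic_zero hκ l)]
  · rw [← measureReal_eq_measureReal_iff]
    exact (h.hasSum_map_Iic hκ k ht).unique (h.hasSum_map_Iic hκ l ht)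

/-- Conditioning on the last waiting time, which has the law of `Δ 0`. Values `x > t` contribute
nothing, since jump times are almost surely nonnegative. -/
lemma IsMLWaitingTimes.measureReal_jumpTime_succ_le (h : IsMLWaitingTimes ν κ Δ P) (hκ : 0 < κ)
    (n : ℕ) (t : ℝ) :
    P.real {ω | jumpTime Δ (n + 1) ω ≤ t} =
      ∫ x in Iic t, P.real {ω | jumpTime Δ n ω ≤ t - x} ∂(P.map (Δ 0)) := by
  have hind : IndepFun (jumpTime Δ n) (Δ n) P := by
    convert! h.indep.indepFun_sum_range_succ h.measurable n using 1
    ext ω; simp [jumpTime]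
  simp_rw [jumpTime_succ]
  rw [measureReal_add_le_eq_integral (h.measurable_jumpTime n) (h.measurable n) hind,
    h.map_eq hκ n 0]
  refine (setIntegral_eq_integral_of_forall_compl_eq_zero fun x hx => ?_).symm
  rw [measureReal_eq_zero_iff]
  refine measure_mono_null (t := {ω | ¬ ∀ k, 0 < Δ k ω}) ?_ (ae_iff.1 (h.ae_pos hκ))
  intro ω (hω : jumpTime Δ n ω ≤ t - x) hpos
  have : 0 ≤ jumpTime Δ n ω := Finset.sum_nonneg fun k _ => (hpos k).le
  have : t < x := not_le.1 hx
  linarith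

/-- Both sides obey the same convolution recursion in `n`; for `n = 0` the claim is the series of
the waiting-time distribution. -/
lemma IsMLWaitingTimes.measureReal_jumpTime_sub (h : IsMLWaitingTimes ν κ Δ P) (hν : 0 < ν)
    (hκ : 0 < κ) (n : ℕ) {t : ℝ} (ht : 0 ≤ t) :
    P.real {ω | jumpTime Δ n ω ≤ t} - P.real {ω | jumpTime Δ (n + 1) ω ≤ t} =
      fppProb ν κ n t := by
  have hprob := Measure.isProbabilityMeasure_map (μ := P) (h.measurable 0).aemeasurable
  induction n generalizing t with
  | zero =>
    have h0 : P.real {ω | jumpTime Δ 0 ω ≤ t} = 1 := by simp [jumpTime, ht]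
    have h1 := h.hasSum_map_Iic hκ 0 ht
    have h2 := (hasSum_nat_add_iff' 1).2 (hasSum_fppTerm hν hκ ht 0)
    have h3 : fppTerm ν κ 0 t 0 = 1 := by simp [fppTerm, fracPow_zero_left]
    rw [Finset.sum_range_one, h3] at h2
    have h4 : (fun j => fppTerm ν κ 0 t (j + 1)) =
        fun j => -((-1) ^ j * ν ^ (j + 1) * fracPow (κ * (j + 1 : ℕ)) t) := by
      ext j; simp [fppTerm, pow_succ]
    rw [h4] at h2
    have h5 := h2.unique h1.neg
    rw [map_measureReal_apply (h.measurable 0) measurableSet_Iic] at h5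
    have h6 : {ω | jumpTime Δ (0 + 1) ω ≤ t} = Δ 0 ⁻¹' Iic t := by
      ext ω; simp [jumpTime]
    rw [h0, h6]; linarith
  | succ n ih =>
    have hmeas : ∀ m, Antitone fun x : ℝ => P.real {ω | jumpTime Δ m ω ≤ t - x} :=
      fun m x y hxy => measureReal_mono fun ω (hω : jumpTime Δ m ω ≤ t - y) =>
        show jumpTime Δ m ω ≤ t - x by linarith
    have hint : ∀ m, Integrable (fun x : ℝ => P.real {ω | jumpTime Δ m ω ≤ t - x})
        ((P.map (Δ 0)).restrict (Iic t)) := fun m =>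
      Integrable.of_bound (hmeas m).measurable.aestronglyMeasurable 1
        (Eventually.of_forall fun x => by
          rw [Real.norm_of_nonneg measureReal_nonneg]; exact measureReal_le_one)
    rw [h.measureReal_jumpTime_succ_le hκ n, h.measureReal_jumpTime_succ_le hκ (n + 1),
      ← integral_sub (hint _) (hint _), ← integral_fppProb_sub hν hκ (h.map_Iic_zero hκ 0)
        (fun t ht => h.hasSum_map_Iic hκ 0 ht) n ht]
    exact setIntegral_congr_fun measurableSet_Iic fun x hx => ih (sub_nonneg.2 hx)

lemma IsMLWaitingTimes.jumpTime_succ_le_subset_ae (h : IsMLWaitingTimes ν κ Δ P) (hκ : 0 < κ)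
    (n : ℕ) (t : ℝ) :
    {ω | jumpTime Δ (n + 1) ω ≤ t} ≤ᵐ[P] {ω | jumpTime Δ n ω ≤ t} := by
  filter_upwards [h.ae_pos hκ] with ω hω (hle : jumpTime Δ (n + 1) ω ≤ t)
  rw [jumpTime_succ] at hle
  show jumpTime Δ n ω ≤ t
  linarith [hω n]

lemma IsMLWaitingTimes.fppProb_nonneg (h : IsMLWaitingTimes ν κ Δ P) (hν : 0 < ν)
    (hκ : 0 < κ) (n : ℕ) {t : ℝ} (ht : 0 ≤ t) : 0 ≤ fppProb ν κ n t := by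
  rw [← h.measureReal_jumpTime_sub hν hκ n ht, sub_nonneg]
  exact ENNReal.toReal_mono (measure_ne_top _ _)
    (measure_mono_ae (h.jumpTime_succ_le_subset_ae hκ n t))

/-- If `T_n ≤ t < T_{n+1}`, monotonicity makes the supremum equal to `n`. An inequality is enough
because probability measures will be compared; thus an unbounded set of indices, where `sSup`
defaults to `0`, need not be excluded. -/
lemma IsMLWaitingTimes.fppProb_le_measureReal_renewalCount (h : IsMLWaitingTimes ν κ Δ P)
    (hν : 0 < ν) (hκ : 0 < κ) (n : ℕ) {t : ℝ} (ht : 0 ≤ t) :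
    fppProb ν κ n t ≤ P.real {ω | renewalCount Δ t ω = n} := by
  have hsub : {ω | jumpTime Δ n ω ≤ t} ≤ᵐ[P]
      ({ω | renewalCount Δ t ω = n} ∪ {ω | jumpTime Δ (n + 1) ω ≤ t} : Set Ω) := by
    filter_upwards [h.ae_pos hκ] with ω hω (hle : jumpTime Δ n ω ≤ t)
    by_cases hn : jumpTime Δ (n + 1) ω ≤ t
    · exact Or.inr hn
    · left
      have hmono : Monotone fun m => jumpTime Δ m ω :=
        monotone_nat_of_le_succ fun m => by
          rw [jumpTime_succ]; linarith [hω m]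
      have hset : {m : ℕ | jumpTime Δ m ω ≤ t} = Iic n := by
        ext m
        refine ⟨fun hm => ?_, fun hm => (hmono hm).trans hle⟩
        by_contra hlt
        have hnm : n + 1 ≤ m := Nat.succ_le_of_lt (not_le.1 hlt)
        exact hn ((hmono hnm).trans hm)
      show sSup {m : ℕ | jumpTime Δ m ω ≤ t} = n
      rw [hset, csSup_Iic]
  rw [← h.measureReal_jumpTime_sub hν hκ n ht, sub_le_iff_le_add]
  exact (ENNReal.toReal_mono (measure_ne_top _ _) (measure_mono_ae hsub)).trans
    (measureReal_union_le _ _)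

end Renewal

end FracPoisson

/-! ### Nonnegativity of the density and mixed Poisson probabilities -/

namespace FracPoisson

open Filter Topology

/-- The function `v * exp (1 - v)` is unimodal with peak at `1`; the hypothesis says that `A` lies
between `v` and `1`. -/
lemma mul_exp_one_sub_le {A v : ℝ} (hA : 0 < A) (h : 0 ≤ (v - A) * (A - 1)) :
    v * Real.exp (1 - v) ≤ A * Real.exp (1 - A) := by
  have h1 : v / A ≤ Real.exp (v - A) := by
    have h2 : v / A - 1 ≤ v - A := by
      rw [div_sub_one hA.ne', div_le_iff₀ hA]; linarith
    have := Real.add_one_le_exp (v / A - 1)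
    exact (by linarith : v / A ≤ Real.exp (v / A - 1)).trans (Real.exp_le_exp.2 h2)
  rw [div_le_iff₀ hA] at h1
  calc v * Real.exp (1 - v) ≤ Real.exp (v - A) * A * Real.exp (1 - v) := by gcongr
    _ = A * (Real.exp (v - A) * Real.exp (1 - v)) := by ring
    _ = _ := by rw [← Real.exp_add]; ring_nf

lemma mul_exp_one_sub_lt_one {v : ℝ} (h : v ≠ 1) : v * Real.exp (1 - v) < 1 := by
  have h1 := Real.add_one_lt_exp (sub_ne_zero.2 h)
  rw [sub_add_cancel] at h1
  calc v * Real.exp (1 - v) < Real.exp (v - 1) * Real.exp (1 - v) := by gcongr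
    _ = 1 := by rw [← Real.exp_add]; simp

/-- A continuous integrable function on `(0, ∞)` all of whose Gamma integrals are nonnegative is
nonnegative. -/
lemma nonneg_of_integral_pow_mul_exp_nonneg {f : ℝ → ℝ} (hf : ContinuousOn f (Ioi 0))
    (hfi : IntegrableOn f (Ioi 0))
    (h : ∀ (n : ℕ) (s : ℝ), 0 < s → 0 ≤ ∫ u in Ioi 0, u ^ n * Real.exp (-s * u) * f u)
    {a : ℝ} (ha : 0 < a) : 0 ≤ f a := by
  by_contra! hneg
  -- Up to a positive constant, `q ^ n` is the weight `u ^ n * exp (-(n / a) * u)`, and `q` has its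
  -- strict maximum `1` at `a`.
  set q : ℝ → ℝ := fun u => u / a * Real.exp (1 - u / a) with hq
  have hqc : Continuous q := by fun_prop
  have hqa : q a = 1 := by simp [hq, ha.ne']
  obtain ⟨δ, hδ, hδa, hδf⟩ : ∃ δ > 0, δ < a ∧ ∀ u, |u - a| ≤ δ → f u ≤ f a / 2 := by
    have h1 : ∀ᶠ u in 𝓝 a, f u < f a / 2 :=
      (hf.continuousAt (Ioi_mem_nhds ha)).eventually_lt_const (by linarith)
    obtain ⟨r, hr, hrf⟩ := Metric.eventually_nhds_iff.1 h1
    refine ⟨min (r / 2) (a / 2), by positivity, by linarith [min_le_right (r / 2) (a / 2)],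
      fun u hu => (hrf ?_).le⟩
    rw [Real.dist_eq]
    linarith [min_le_left (r / 2) (a / 2)]
  set θ₂ := max (q (a - δ)) (q (a + δ)) with hθ₂
  have hθ₂0 : 0 < θ₂ := lt_max_of_lt_right (by simp only [hq]; positivity)
  have hθ₂1 : θ₂ < 1 := by
    refine max_lt (mul_exp_one_sub_lt_one ?_) (mul_exp_one_sub_lt_one ?_) <;>
      rw [ne_eq, div_eq_one_iff_eq ha.ne'] <;> linarith
  have hfar : ∀ u, 0 < u → δ < |u - a| → q u ≤ θ₂ := by
    intro u hu hua
    rcases lt_abs.1 hua with h1 | h1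
    · refine le_max_of_le_right (mul_exp_one_sub_le (by positivity) ?_)
      rw [← sub_div, div_sub_one ha.ne']
      exact mul_nonneg (div_nonneg (by linarith) ha.le) (div_nonneg (by linarith) ha.le)
    · refine le_max_of_le_left (mul_exp_one_sub_le (div_pos (by linarith) ha) ?_)
      rw [← sub_div, div_sub_one ha.ne']
      exact mul_nonneg_of_nonpos_of_nonpos (div_nonpos_of_nonpos_of_nonneg (by linarith) ha.le)
        (div_nonpos_of_nonpos_of_nonneg (by linarith) ha.le)
  obtain ⟨θ₁, hθ₁, hθ₁1⟩ := exists_between hθ₂1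
  obtain ⟨η, hη, hηδ, hηq⟩ : ∃ η > 0, η ≤ δ ∧ ∀ u, |u - a| ≤ η → θ₁ ≤ q u := by
    have h1 : ∀ᶠ u in 𝓝 a, θ₁ < q u :=
      hqc.continuousAt.eventually_const_lt (by rw [hqa]; exact hθ₁1)
    obtain ⟨r, hr, hrq⟩ := Metric.eventually_nhds_iff.1 h1
    refine ⟨min (r / 2) δ, by positivity, min_le_right _ _, fun u hu => (hrq ?_).le⟩
    rw [Real.dist_eq]
    linarith [min_le_left (r / 2) δ]
  have hsub : Icc (a - η) (a + η) ⊆ Ioi 0 := fun u hu => by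
    have : 0 < u := by linarith [hu.1]
    exact this
  -- Near `a` the integral of `q ^ n * f` picks up at most `θ₁ ^ n * (f a / 2) * 2η < 0`, and away
  -- from `a` at most `θ₂ ^ n ∫ |f|`. As `θ₂ < θ₁`, large `n` is contradictory. The condition `1 ≤
  -- n` makes the rate `n / a` positive.
  have hbound : ∀ n : ℕ, 1 ≤ n →
      θ₁ ^ n * (-(f a / 2) * (2 * η)) ≤ θ₂ ^ n * ∫ u in Ioi 0, |f u| := by
    intro n hn
    have hn0 : (0 : ℝ) < n := by exact_mod_cast hn
    have e1 : ∀ u, q u ^ n * f u =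
        (Real.exp 1 / a) ^ n * (u ^ n * Real.exp (-(n / a) * u) * f u) := by
      intro u
      have : Real.exp (1 - u / a) ^ n = Real.exp 1 ^ n * Real.exp (-(n / a) * u) := by
        rw [← Real.exp_nat_mul, ← Real.exp_nat_mul, ← Real.exp_add]; congr 1; ring
      simp only [hq]
      rw [mul_pow, this, div_pow, div_pow]; ring
    have h0 : 0 ≤ ∫ u in Ioi 0, q u ^ n * f u := by
      simp_rw [e1]
      rw [integral_const_mul]
      exact mul_nonneg (by positivity) (h n _ (by positivity))
    have hle : ∀ u ∈ Ioi (0 : ℝ), q u ^ n * f u ≤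
        (Icc (a - η) (a + η)).indicator (fun _ => θ₁ ^ n * (f a / 2)) u + θ₂ ^ n * |f u| := by
      intro u hu
      have hu : 0 < u := hu
      have hq0 : 0 ≤ q u := by simp only [hq]; positivity
      have hθ₁0 : 0 ≤ θ₁ := by linarith
      have hp2 : 0 ≤ θ₂ ^ n * |f u| := by positivity
      by_cases h1 : u ∈ Icc (a - η) (a + η)
      · have hua : |u - a| ≤ η := abs_le.2 ⟨by linarith [h1.1], by linarith [h1.2]⟩
        rw [indicator_of_mem h1]
        have h2 := hδf u (hua.trans hηδ)
        have h3 := pow_le_pow_left₀ hθ₁0 (hηq u hua) n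
        have h4 : 0 ≤ θ₁ ^ n := by positivity
        nlinarith
      · rw [indicator_of_notMem h1, zero_add]
        rcases le_or_gt |u - a| δ with h2 | h2
        · exact (mul_nonpos_of_nonneg_of_nonpos (by positivity)
            ((hδf u h2).trans (by linarith))).trans hp2
        · calc q u ^ n * f u ≤ q u ^ n * |f u| := by gcongr; exact le_abs_self _
            _ ≤ _ := by gcongr; exact hfar u hu h2
    have hi1 : IntegrableOn ((Icc (a - η) (a + η)).indicator fun _ => θ₁ ^ n * (f a / 2))
        (Ioi 0) := by
      refine Integrable.integrableOn ?_
      rw [integrable_indicator_iff measurableSet_Icc]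
      exact integrableOn_const (by simp)
    have hi2 : IntegrableOn (fun u => θ₂ ^ n * |f u|) (Ioi 0) := hfi.abs.const_mul _
    have hi3 : IntegrableOn (fun u => q u ^ n * f u) (Ioi 0) := by
      refine Integrable.mono' hfi.abs
        ((hqc.pow n).aestronglyMeasurable.mul hfi.aestronglyMeasurable) ?_
      filter_upwards [ae_restrict_mem measurableSet_Ioi] with u hu
      have hu : 0 < u := hu
      have hq0 : 0 ≤ q u := by simp only [hq]; positivity
      have hq1 : q u ≤ 1 := by
        have := mul_exp_one_sub_le (A := 1) (v := u / a) zero_lt_one (by simp)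
        simpa using this
      rw [norm_mul, norm_pow, Real.norm_of_nonneg hq0, Real.norm_eq_abs]
      exact mul_le_of_le_one_left (abs_nonneg _) (pow_le_one₀ hq0 hq1)
    have h5 := h0.trans (setIntegral_mono_on hi3 (hi1.add hi2) measurableSet_Ioi hle)
    rw [integral_add' hi1 hi2, integral_const_mul, setIntegral_indicator measurableSet_Icc,
      inter_eq_right.2 hsub, setIntegral_const, measureReal_def, Real.volume_Icc,
      ENNReal.toReal_ofReal (by linarith), smul_eq_mul] at h5
    linarith
  have hlim : Tendsto (fun n : ℕ => (θ₂ / θ₁) ^ n * ∫ u in Ioi 0, |f u|) atTop (𝓝 0) := by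
    simpa using (tendsto_pow_atTop_nhds_zero_of_lt_one (div_nonneg hθ₂0.le (by linarith))
      ((div_lt_one (by linarith)).2 hθ₁)).mul_const (∫ u in Ioi 0, |f u|)
  have hc : 0 < -(f a / 2) * (2 * η) := by nlinarith
  have := ge_of_tendsto hlim (b := -(f a / 2) * (2 * η)) (by
    filter_upwards [eventually_ge_atTop 1] with n hn
    have hθ₁0 : 0 < θ₁ ^ n := pow_pos (by linarith) n
    rw [div_pow, div_mul_eq_mul_div, le_div_iff₀ hθ₁0, mul_comm]
    exact hbound n hn)
  linarith

/-- The power series of `s ↦ e ^ (-s u) (s u) ^ n / n!`. -/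
lemma hasSum_poisson_weight (s u : ℝ) (n : ℕ) :
    HasSum (fun m : ℕ => (-1) ^ m * ((m + n).choose n : ℝ) * s ^ (m + n) *
      (u ^ (m + n) / ((m + n).factorial : ℝ)))
      (Real.exp (-(s * u)) * (s * u) ^ n / (n.factorial : ℝ)) := by
  have h := (NormedSpace.expSeries_div_hasSum_exp (-(s * u))).mul_right
    ((s * u) ^ n / (n.factorial : ℝ))
  rw [← Real.exp_eq_exp_ℝ, ← mul_div_assoc] at h
  convert! h using 1
  ext m
  rw [Nat.cast_choose ℝ (Nat.le_add_left n m), Nat.add_sub_cancel, neg_pow]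
  have h1 : (m.factorial : ℝ) ≠ 0 := by positivity
  have h2 : (n.factorial : ℝ) ≠ 0 := by positivity
  have h3 : ((m + n).factorial : ℝ) ≠ 0 := by positivity
  field_simp
  ring

/-- Terms with `j < n` vanish. In this form the series is that of `hasSum_poisson_weight` at `s = ν
t ^ κ`, with `u ^ k / k!` replaced by `1 / Γ(κk + 1)`, its integral against the density. -/
lemma hasSum_fppProb {ν κ t : ℝ} (hν : 0 < ν) (hκ : 0 < κ) (ht : 0 ≤ t) (n : ℕ) :
    HasSum (fun m : ℕ => (-1) ^ m * ((m + n).choose n : ℝ) * (ν * t ^ κ) ^ (m + n) *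
      (1 / Real.Gamma (κ * (m + n : ℕ) + 1))) (fppProb ν κ n t) := by
  have h := (hasSum_nat_add_iff' n).2 (hasSum_fppTerm hν hκ ht n)
  have h0 : ∑ i ∈ Finset.range n, fppTerm ν κ n t i = 0 :=
    Finset.sum_eq_zero fun i hi => by
      simp [fppTerm, Nat.choose_eq_zero_of_lt (Finset.mem_range.1 hi)]
  rw [h0, sub_zero] at h
  convert! h using 1
  ext m
  rw [fppTerm, mul_assoc _ (ν ^ _), pow_mul_fracPow ht]
  have : (-1 : ℝ) ^ (m + n + n) = (-1) ^ m := by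
    rw [add_assoc, pow_add, ← two_mul, pow_mul (-1 : ℝ) 2]; simp
  rw [this]; ring

lemma integrableOn_mlDensity_mul {κ : ℝ} (hκ0 : 0 < κ) (hκ1 : κ < 1) {g : ℝ → ℝ}
    (hg : Measurable g) (n : ℕ) (a : ℝ) (hgle : ∀ u, 0 < u → |g u| ≤ u ^ n * Real.exp (a * u)) :
    IntegrableOn (fun u => g u * mlDensity κ u) (Ioi 0) := by
  obtain ⟨C, hC⟩ := exists_abs_mlDensity_le hκ0 hκ1 (a + 1)
  refine Integrable.mono' ((integrableOn_pow_mul_exp_neg zero_lt_one n).const_mul C)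
    (hg.aestronglyMeasurable.mul (((continuousOn_mlDensity hκ0 hκ1).mono
      Ioi_subset_Ici_self).aestronglyMeasurable measurableSet_Ioi)) ?_
  filter_upwards [ae_restrict_mem measurableSet_Ioi] with u hu
  have hu : 0 < u := hu
  rw [norm_mul, Real.norm_eq_abs, Real.norm_eq_abs]
  calc |g u| * |mlDensity κ u| ≤ u ^ n * Real.exp (a * u) * (C * Real.exp (-(a + 1) * u)) :=
        mul_le_mul (hgle u hu) (hC u hu.le) (abs_nonneg _) (by positivity)
    _ = C * (u ^ n * (Real.exp (a * u) * Real.exp (-(a + 1) * u))) := by ring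
    _ = _ := by rw [← Real.exp_add]; ring_nf

lemma integrableOn_mlDensity {κ : ℝ} (hκ0 : 0 < κ) (hκ1 : κ < 1) :
    IntegrableOn (mlDensity κ) (Ioi 0) := by
  simpa using integrableOn_mlDensity_mul hκ0 hκ1 (g := fun _ => 1) measurable_const 0 0
    (fun u _ => by simp)

/-- The mixed Poisson probabilities with mixing density `mlDensity κ`. -/
lemma integral_poisson_weight_mul_mlDensity {ν κ t : ℝ} (hν : 0 < ν) (hκ0 : 0 < κ) (hκ1 : κ < 1)
    (ht : 0 ≤ t) (n : ℕ) :
    ∫ u in Ioi 0, Real.exp (-(ν * t ^ κ * u)) * (ν * t ^ κ * u) ^ n / (n.factorial : ℝ) *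
      mlDensity κ u = fppProb ν κ n t := by
  set s := ν * t ^ κ with hs
  have hs0 : 0 ≤ s := mul_nonneg hν.le (Real.rpow_nonneg ht κ)
  set bd : ℕ → ℝ → ℝ := fun m u => ((m + n).choose n : ℝ) * s ^ (m + n) *
      (|u| ^ (m + n) / ((m + n).factorial : ℝ)) * |mlDensity κ u| with hbd
  have hbs : ∀ u, HasSum (fun m => bd m u)
      (Real.exp (s * |u|) * (s * |u|) ^ n / (n.factorial : ℝ) * |mlDensity κ u|) := fun u => by
    -- The series of absolute values is the same expansion at `-s`, up to the sign `(-1) ^ n`.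
    have := ((hasSum_poisson_weight (-s) |u| n).mul_left ((-1) ^ n)).mul_right |mlDensity κ u|
    convert! this using 1
    · ext m
      have e : (-1 : ℝ) ^ n * ((-1) ^ m * (-1) ^ (m + n)) = 1 := by
        rw [← pow_add, ← pow_add, show n + (m + (m + n)) = 2 * (m + n) by ring, pow_mul]; simp
      simp only [hbd]
      rw [neg_pow s]
      linear_combination (-((m + n).choose n : ℝ) * s ^ (m + n) *
        (|u| ^ (m + n) / ((m + n).factorial : ℝ)) * |mlDensity κ u|) * e
    · have e : (-1 : ℝ) ^ n * (-1) ^ n = 1 := by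
        rw [← pow_add, ← two_mul, pow_mul]; simp
      rw [neg_mul, neg_neg, neg_pow (s * |u|)]
      linear_combination (-(Real.exp (s * |u|) * (s * |u|) ^ n / (n.factorial : ℝ) *
        |mlDensity κ u|)) * e
  have hm : AEStronglyMeasurable (mlDensity κ) (volume.restrict (Ioi 0)) :=
    (integrableOn_mlDensity hκ0 hκ1).aestronglyMeasurable
  have h := hasSum_integral_of_dominated_convergence (μ := volume.restrict (Ioi (0 : ℝ)))
    (F := fun (m : ℕ) u => (-1) ^ m * ((m + n).choose n : ℝ) * s ^ (m + n) *
      (u ^ (m + n) / ((m + n).factorial : ℝ)) * mlDensity κ u)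
    (f := fun u => Real.exp (-(s * u)) * (s * u) ^ n / (n.factorial : ℝ) * mlDensity κ u) bd
    (fun m => AEStronglyMeasurable.mul (Measurable.aestronglyMeasurable (by fun_prop)) hm)
    (fun m => Eventually.of_forall fun u => by
      simp only [hbd, norm_mul, norm_div, norm_pow, norm_neg, norm_one, one_pow, one_mul,
        Real.norm_eq_abs, abs_of_nonneg hs0, Nat.abs_cast, le_refl])
    (Eventually.of_forall fun u => (hbs u).summable)
    (by
      simp_rw [fun u => (hbs u).tsum_eq]
      have := (integrableOn_mlDensity_mul hκ0 hκ1 (g := fun u => u ^ n * Real.exp (s * u))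
        (by fun_prop) n s fun u hu => (abs_of_nonneg (by positivity)).le).abs.const_mul
        (s ^ n / (n.factorial : ℝ))
      refine this.congr ?_
      filter_upwards [ae_restrict_mem measurableSet_Ioi] with u hu
      have hu : 0 < u := hu
      rw [abs_mul, abs_of_nonneg (show 0 ≤ u ^ n * Real.exp (s * u) by positivity),
        abs_of_pos hu]
      ring)
    (Eventually.of_forall fun u => (hasSum_poisson_weight s u n).mul_right _)
  refine h.unique ?_
  convert! hasSum_fppProb hν hκ0 ht n using 1
  ext m
  have e : ∀ u, (-1) ^ m * ((m + n).choose n : ℝ) * s ^ (m + n) *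
      (u ^ (m + n) / ((m + n).factorial : ℝ)) * mlDensity κ u =
      (-1) ^ m * ((m + n).choose n : ℝ) * s ^ (m + n) / ((m + n).factorial : ℝ) *
        (u ^ (m + n) * mlDensity κ u) := fun u => by ring
  simp_rw [e]
  rw [integral_const_mul, integral_pow_mul_mlDensity hκ0 hκ1, ← hs]
  have h3 : ((m + n).factorial : ℝ) ≠ 0 := by positivity
  field_simp

lemma fppProb_one_one {ν : ℝ} (hν : 0 < ν) (n : ℕ) :
    fppProb ν 1 n 1 = Real.exp (-ν) * ν ^ n / (n.factorial : ℝ) := by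
  have h := hasSum_poisson_weight ν 1 n
  have h2 := hasSum_fppProb hν zero_lt_one zero_le_one n
  simp only [Real.one_rpow, mul_one, one_mul, one_pow, Real.Gamma_nat_eq_factorial] at h h2
  exact h2.unique h

/-- Nonnegativity of the density of the Mittag-Leffler distribution. -/
lemma mlDensity_nonneg {ν κ : ℝ} (hν : 0 < ν) (hκ0 : 0 < κ) (hκ1 : κ < 1)
    (h : ∀ (n : ℕ) (t : ℝ), 0 ≤ t → 0 ≤ fppProb ν κ n t) {u : ℝ} (hu : 0 < u) :
    0 ≤ mlDensity κ u := by
  refine nonneg_of_integral_pow_mul_exp_nonneg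
    ((continuousOn_mlDensity hκ0 hκ1).mono Ioi_subset_Ici_self) (integrableOn_mlDensity hκ0 hκ1)
    (fun n s hs => ?_) hu
  -- At this time `ν t ^ κ = s`, so varying `t` with `ν` fixed reaches every `s > 0`.
  have ht : 0 ≤ (s / ν) ^ (1 / κ) := by positivity
  have e : ν * ((s / ν) ^ (1 / κ)) ^ κ = s := by
    rw [← Real.rpow_mul (by positivity), one_div_mul_cancel hκ0.ne', Real.rpow_one]
    field_simp
  have h1 := h n _ ht
  rw [← integral_poisson_weight_mul_mlDensity hν hκ0 hκ1 ht, e] at h1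
  have e2 : ∀ u, u ^ n * Real.exp (-s * u) * mlDensity κ u = (n.factorial : ℝ) / s ^ n *
      (Real.exp (-(s * u)) * (s * u) ^ n / (n.factorial : ℝ) * mlDensity κ u) := fun u => by
    have h3 : (n.factorial : ℝ) ≠ 0 := by positivity
    rw [mul_pow, neg_mul]; field_simp
  simp_rw [e2]
  rw [integral_const_mul]
  exact mul_nonneg (by positivity) h1

end FracPoisson

/-! ### The mixture law and the extension of the probability space -/

namespace FracPoisson

open Filter Topology

lemma isProbabilityMeasure_mlMeasure {κ : ℝ} (hκ0 : 0 < κ)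
    (hpos : κ < 1 → ∀ u, 0 < u → 0 ≤ mlDensity κ u) : IsProbabilityMeasure (mlMeasure κ) := by
  rw [mlMeasure]
  split_ifs with hκ1
  · refine ⟨?_⟩
    have h := integral_pow_mul_mlDensity hκ0 hκ1 0
    simp only [pow_zero, one_mul, Nat.factorial_zero, Nat.cast_one, Nat.cast_zero, mul_zero,
      zero_add, Real.Gamma_one, div_one] at h
    rw [withDensity_apply _ MeasurableSet.univ, Measure.restrict_univ,
      ← ofReal_integral_eq_lintegral_ofReal (integrableOn_mlDensity hκ0 hκ1), h,
      ENNReal.ofReal_one]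
    filter_upwards [ae_restrict_mem measurableSet_Ioi] with u hu using hpos hκ1 u hu
  · infer_instance

lemma lintegral_poissonKernel_singleton {ν κ : ℝ} (hν : 0 < ν) (hκ0 : 0 < κ) (hκ1 : κ ≤ 1)
    (hpos : κ < 1 → ∀ u, 0 < u → 0 ≤ mlDensity κ u) (n : ℕ) :
    ∫⁻ u, poissonKernel ν u {n} ∂(mlMeasure κ) = ENNReal.ofReal (fppProb ν κ n 1) := by
  have hker : ∀ u : ℝ, poissonKernel ν u {n} = ENNReal.ofReal
      (Real.exp (-((ν * u).toNNReal : ℝ)) * ((ν * u).toNNReal : ℝ) ^ n / (n.factorial : ℝ)) :=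
    fun u => poissonMeasure_singleton _ n
  rw [mlMeasure]
  split_ifs with h1
  · have hint := integral_poisson_weight_mul_mlDensity hν hκ0 h1 zero_le_one n
    simp only [Real.one_rpow, mul_one] at hint
    rw [lintegral_withDensity_eq_lintegral_mul₀
      (integrableOn_mlDensity hκ0 h1).aestronglyMeasurable.aemeasurable.ennreal_ofReal
      ((poissonKernel ν).measurable_coe (measurableSet_singleton n)).aemeasurable, ← hint,
      ofReal_integral_eq_lintegral_ofReal]
    · refine setLIntegral_congr_fun measurableSet_Ioi fun u hu => ?_
      have hu0 : 0 < u := hu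
      have hνu : 0 ≤ ν * u := by positivity
      simp only [Pi.mul_apply]
      rw [hker, Real.coe_toNNReal _ hνu, ← ENNReal.ofReal_mul (hpos h1 u hu), mul_comm]
    · refine ((integrableOn_mlDensity_mul hκ0 h1 (g := fun u => u ^ n * Real.exp (-ν * u))
        (by fun_prop) n (-ν) fun u hu => (abs_of_nonneg (by positivity)).le).const_mul
        (ν ^ n / (n.factorial : ℝ))).congr (Eventually.of_forall fun u => ?_)
      simp only [neg_mul, mul_pow]
      ring
    · filter_upwards [ae_restrict_mem measurableSet_Ioi] with u hu
      have hu0 : 0 < u := hu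
      exact mul_nonneg (by positivity) (hpos h1 u hu)
  · obtain rfl : κ = 1 := le_antisymm hκ1 (not_lt.1 h1)
    rw [lintegral_dirac, hker, mul_one, Real.coe_toNNReal _ hν.le, fppProb_one_one hν]

lemma measure_le_of_singleton_le {α : Type*} [MeasurableSpace α] [Countable α]
    [MeasurableSingletonClass α] {μ μ' : Measure α} (h : ∀ a, μ {a} ≤ μ' {a}) : μ ≤ μ' := by
  refine Measure.le_iff.2 fun s hs => ?_
  rw [← Measure.tsum_indicator_apply_singleton μ s hs,
    ← Measure.tsum_indicator_apply_singleton μ' s hs]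
  exact ENNReal.tsum_le_tsum fun a => indicator_le_indicator (h a)

/-- The law of the fractional Poisson process at time `1` is a mixture of Poisson distributions. -/
theorem IsFractionalPoisson.exists_mixture {ν κ : ℝ} (hν : 0 < ν) (hκ0 : 0 < κ) (hκ1 : κ ≤ 1)
    {Ω : Type*} [MeasurableSpace Ω] {P : Measure Ω} {N : Ω → ℕ}
    (hN : IsFractionalPoisson ν κ N P) :
    IsProbabilityMeasure (mlMeasure κ) ∧ AEMeasurable N P ∧
      P.map N = (mlMeasure κ).bind (poissonKernel ν) := by
  obtain ⟨Ω', _, P', Δ, hP', hΔ, hid⟩ := hN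
  have hpos : κ < 1 → ∀ u, 0 < u → 0 ≤ mlDensity κ u := fun h u hu =>
    mlDensity_nonneg hν hκ0 h (fun n t ht => hΔ.fppProb_nonneg hν hκ0 n ht) hu
  have hprob := isProbabilityMeasure_mlMeasure hκ0 hpos
  refine ⟨hprob, hid.aemeasurable_fst, ?_⟩
  rw [hid.map_eq]
  have := Measure.isProbabilityMeasure_map hid.aemeasurable_snd
  -- Two probability measures, one dominated by the other, coincide.
  refine (Measure.eq_of_le_of_isProbabilityMeasure (measure_le_of_singleton_le fun n => ?_)).symm
  rw [Measure.bind_apply (measurableSet_singleton n) (poissonKernel ν).measurable.aemeasurable,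
    lintegral_poissonKernel_singleton hν hκ0 hκ1 hpos,
    Measure.map_apply_of_aemeasurable hid.aemeasurable_snd (measurableSet_singleton n)]
  exact ENNReal.ofReal_le_of_le_toReal
    (hΔ.fppProb_le_measureReal_renewalCount hν hκ0 n zero_le_one)

/-- If the law of `N` is the mixture of the kernel `η` with respect to `μ`, then the probability
space can be extended so that it carries a variable `U ∼ μ` with `N ∣ U ∼ η U`. -/
theorem exists_extension_hasCondDistrib {Ω α β : Type*} [MeasurableSpace Ω] [MeasurableSpace α]
    [MeasurableSpace β] [StandardBorelSpace β] [Nonempty β] {P : Measure Ω}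
    [IsProbabilityMeasure P] {N : Ω → α} (hN : AEMeasurable N P) {μ : Measure β}
    [IsProbabilityMeasure μ] {η : Kernel β α} [IsMarkovKernel η] (h : P.map N = μ.bind η) :
    ∃ ρ : Measure (Ω × β), IsProbabilityMeasure ρ ∧ ρ.fst = P ∧
      HasLaw (fun x : Ω × β => x.2) μ ρ ∧
      HasCondDistrib (fun x : Ω × β => N x.1) (fun x : Ω × β => x.2) η ρ := by
  -- This is the intended joint law of `(N, U)`; its first marginal is the law of `N` by hypothesis.
  set π : Measure (α × β) := (μ ⊗ₘ η).map Prod.swap with hπ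
  have : IsProbabilityMeasure π := Measure.isProbabilityMeasure_map (by fun_prop)
  have hfst : π.fst = P.map N := by
    rw [h, hπ, Measure.fst_map_swap, Measure.snd_compProd]
  set N' := hN.mk N with hN'
  have hN'm : Measurable N' := hN.measurable_mk
  -- Given `ω`, the new coordinate is drawn from the conditional law of `U` given the value `N' ω`.
  -- The measurable version `N'` is needed for this to be a kernel.
  set ρ : Measure (Ω × β) := P ⊗ₘ (π.condKernel.comap N' hN'm) with hρ
  have hρfst : ρ.fst = P := Measure.fst_compProd _ _
  have hae : ∀ᵐ x ∂ρ, N x.1 = N' x.1 := by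
    refine ae_of_ae_map (f := Prod.fst) measurable_fst.aemeasurable (p := fun ω => N ω = N' ω) ?_
    rw [← Measure.fst, hρfst]
    exact hN.ae_eq_mk
  have hmap : ρ.map (fun x => (N' x.1, x.2)) = π := by
    rw [← π.disintegrate π.condKernel, hfst, Measure.map_congr hN.ae_eq_mk]
    ext s hs
    rw [Measure.map_apply (by fun_prop) hs, hρ, Measure.compProd_apply (hs.preimage (by fun_prop)),
      Measure.compProd_apply hs, lintegral_map (Kernel.measurable_kernel_prodMk_left hs) hN'm]
    rfl
  have hpair : ρ.map (fun x => (x.2, N x.1)) = μ ⊗ₘ η := by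
    have e : (fun x : Ω × β => (x.2, N x.1)) =ᵐ[ρ] Prod.swap ∘ fun x => (N' x.1, x.2) := by
      filter_upwards [hae] with x hx
      simp [hx]
    rw [Measure.map_congr e, ← Measure.map_map measurable_swap (by fun_prop), hmap, hπ,
      Measure.map_map measurable_swap measurable_swap, Prod.swap_swap_eq, Measure.map_id]
  have hpm : AEMeasurable (fun x : Ω × β => (x.2, N x.1)) ρ :=
    measurable_snd.aemeasurable.prodMk ⟨fun x => N' x.1, by fun_prop, hae⟩
  have hsnd : ρ.map (fun x => x.2) = μ := by
    rw [← Measure.fst_compProd μ η, ← hpair, Measure.fst,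
      AEMeasurable.map_map_of_aemeasurable measurable_fst.aemeasurable hpm]
    rfl
  exact ⟨ρ, inferInstance, hρfst, ⟨measurable_snd.aemeasurable, hsnd⟩, ⟨hpm, by rw [hsnd, hpair]⟩⟩

end FracPoisson

/-- If `N ∼ FP(ν, κ)`, then on an extension `Ω × ℝ` of the probability space on which `N` lives
there is a random variable `U ∼ ML(κ)` (the second coordinate) such that the conditional
distribution of `N` given `U` is `Poisson(ν U)`. -/
theorem corollary1 (ν κ : ℝ) (hν : 0 < ν) (hκ0 : 0 < κ) (hκ1 : κ ≤ 1)
    {Ω : Type*} [MeasurableSpace Ω] (P : Measure Ω) [IsProbabilityMeasure P] (N : Ω → ℕ)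
    (hN : FracPoisson.IsFractionalPoisson ν κ N P) :
    ∃ ρ : Measure (Ω × ℝ), IsProbabilityMeasure ρ ∧ ρ.fst = P ∧
      HasLaw (fun x : Ω × ℝ => x.2) (FracPoisson.mlMeasure κ) ρ ∧
      HasCondDistrib (fun x : Ω × ℝ => N x.1) (fun x : Ω × ℝ => x.2)
        (FracPoisson.poissonKernel ν) ρ := by
  obtain ⟨hprob, hNm, hmix⟩ := hN.exists_mixture hν hκ0 hκ1
  exact FracPoisson.exists_extension_hasCondDistrib hNm hmix
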